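/- Let $n\ge 2$ boxes each contain an independent prize of value $1$ with probability $\mu\in(0,1]$ and $0$ otherwise; let $G_0$ denote this prior. Each box commits to a signal about its prize; by definition a pure strategy is a probability distribution $F$ on $[0,1]$ (of the posterior mean) with mean $\mu$, i.e. an element of $M(\mu)$, and a mixed strategy is a Borel probability measure on $M(\mu)$ with the weak topology. The fully revealing signal is the strategy $G_0$. A searcher observes the chosen distributions $F_1,\dots,F_n$ and then inspects boxes one at a time. Inspecting a box costs $c\ge 0$, reveals its independent reward $x_i\sim F_i$ and delays the continuation by one period, discounted by $\beta\in(0,1]$. At any time she may stop and take one of the boxes already inspected; before any inspection she may instead decline to search and keep an outside option of value $0$. It is assumed that $\beta\mu>c$. The payoff of a box is the probability that it is taken. The reservation price $z_F$ of $F\in M(\mu)$ is the solution of $z=-c+\beta\int\max(x,z)\,dF(x)$. A (symmetric) equilibrium consists of a (common) strategy of the boxes and of a policy of the searcher for every profile of distributions such that (i) her policy maximizes her expected discounted utility among all policies and is fair: uninspected boxes with the maximal reservation price among the uninspected ones are inspected next with equal probabilities, and inspected boxes with the maximal reward among the inspected ones are taken with equal probabilities; (ii) no box gains by deviating to another mixed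 strategy. Suppose there are frictions: $c>0$ and/or $\beta<1$. (a) If $\mu\ge 1-(1/n)^{1/(n-1)}$, then among pure strategies there is a unique symmetric equilibrium strategy, namely the fully revealing one $G_0$ (a pure strategy is a symmetric equilibrium if and only if it is $G_0$). Unless $n=2$ and $\mu=1/2$, the same holds among all mixed strategies. (b) For every $\mu\in(0,1)$ there is an $N$, depending only on $\mu$, such that for all $n\ge N$ and all $c,\beta$ as above $G_0$ is the unique symmetric equilibrium in pure strategies. (c) Every $F\in M(\mu)$ has exactly one reservation price, and $z_F<z_{G_0}$ for every $F\in M(\mu)$ with $F\ne G_0$. -/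

import Mathlib

open MeasureTheory
open scoped unitInterval ENNReal

noncomputable section

namespace PandoraGame

/-! ### Strategies of the boxes -/

/-- A pure strategy of a box whose quality is Bernoulli with mean `μ`: a probability
distribution on `[0,1]` (of posterior means) with mean `μ`. -/
def PureStrategy (μ : ℝ) : Type :=
  {F : ProbabilityMeasure I // ∫ x, (x : ℝ) ∂(F : Measure I) = μ}

namespace PureStrategy

variable {μ : ℝ}

/-- The distribution of the posterior mean, as a measure on `[0,1]`. -/
def law (F : PureStrategy μ) : Measure I := (F.1 : Measure I)

instance (F : PureStrategy μ) : IsProbabilityMeasure F.law :=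
  inferInstanceAs (IsProbabilityMeasure (F.1 : Measure I))

/-- The topology of weak convergence of probability measures. -/
instance : TopologicalSpace (PureStrategy μ) :=
  inferInstanceAs (TopologicalSpace {F : ProbabilityMeasure I //
    ∫ x, (x : ℝ) ∂(F : Measure I) = μ})

/-- The Borel sigma-algebra of the topology of weak convergence. -/
instance : MeasurableSpace (PureStrategy μ) := borel _

instance : BorelSpace (PureStrategy μ) := ⟨rfl⟩

/-- The strategy of a fully revealing signal: the posterior mean is `1` with probability `μ`
and `0` with probability `1 - μ`, so its distribution is the prior itself. -/
def fullyRevealing (μ : ℝ) (h0 : 0 ≤ μ) (h1 : μ ≤ 1) : PureStrategy μ :=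
  ⟨⟨ENNReal.ofReal (1 - μ) • Measure.dirac (0 : I) + ENNReal.ofReal μ • Measure.dirac (1 : I),
    ⟨by
      have h : (0 : ℝ) ≤ 1 - μ := by linarith
      simp [← ENNReal.ofReal_add h h0]⟩⟩, by
    have hint : ∀ a : I, Integrable (fun x : I => (x : ℝ)) (Measure.dirac a) := fun a =>
      integrable_dirac (by simp)
    rw [ProbabilityMeasure.coe_mk, integral_add_measure
      ((hint 0).smul_measure ENNReal.ofReal_ne_top) ((hint 1).smul_measure ENNReal.ofReal_ne_top)]
    simp [h0]⟩

end PureStrategy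

/-- A mixed strategy: a Borel probability distribution over the pure strategies. -/
abbrev MixedStrategy (μ : ℝ) : Type := ProbabilityMeasure (PureStrategy μ)

/-- A pure strategy regarded as a (degenerate) mixed strategy. -/
def PureStrategy.toMixed {μ : ℝ} (F : PureStrategy μ) : MixedStrategy μ :=
  ⟨Measure.dirac F, inferInstance⟩

/-! ### The searcher -/

/-- `z` is a reservation price of a box with distribution `F`, for inspection cost `c` and
discount factor `β`: `z = -c + β (∫_{x ≤ z} z dF + ∫_{x > z} x dF)`. -/
def IsReservationPrice {μ : ℝ} (c β : ℝ) (F : PureStrategy μ) (z : ℝ) : Prop :=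
  z = -c + β * ∫ x, max (x : ℝ) z ∂F.law

/-- What the searcher can do next: inspect box `i`, stop and take the inspected box `i`, or
decline to search and keep the outside option `0`. -/
inductive Action (n : ℕ) : Type
  | inspect (i : Fin n)
  | take (i : Fin n)
  | quit

/-- A (randomized, history-dependent) policy of the searcher facing `n` boxes. A history is the
list `l` of the boxes inspected so far, the latest one first, with the rewards seen in them.
`prob l x a` is the probability that the next action is `a`, after the history of boxes `l`,
when the rewards in the boxes are `x`. A policy sees only the rewards of inspected boxes. Only inspected boxes
can be taken, and no box is inspected twice. Since all rewards are at least the outside option `0`, a searcher who has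
inspected some box stops by taking an inspected box. -/
structure Policy (n : ℕ) where
  prob : List (Fin n) → (Fin n → I) → Action n → ℝ
  prob_nonneg : ∀ l x a, 0 ≤ prob l x a
  prob_sum : ∀ l x,
    ∑ i, prob l x (.inspect i) + ∑ i, prob l x (.take i) + prob l x .quit = 1
  inspect_legal : ∀ l x i, i ∈ l → prob l x (.inspect i) = 0
  take_legal : ∀ l x i, i ∉ l → prob l x (.take i) = 0
  quit_legal : ∀ l x, l ≠ [] → prob l x .quit = 0
  adapted : ∀ l x y a, (∀ i ∈ l, x i = y i) → prob l x a = prob l y a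
  measurable_prob : ∀ l a, Measurable fun x => prob l x a

namespace Policy

variable {n : ℕ}

/-- Expected payoff of the searcher from history `l` on, over the randomization of the policy,
when the rewards in the boxes are `x` and at most `k` more decisions are made. An inspection
costs `c` and delays everything that follows by one period. -/
def searcherValue (π : Policy n) (c β : ℝ) : ℕ → List (Fin n) → (Fin n → I) → ℝ
  | 0, _, _ => 0
  | k + 1, l, x =>
      ∑ i, π.prob l x (.inspect i) * (-c + β * π.searcherValue c β k (i :: l) x)
        + ∑ i, π.prob l x (.take i) * (x i : ℝ)

/-- Probability, over the randomization of the policy, that box `i` is eventually taken, from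
history `l` on, when the rewards in the boxes are `x` and at most `k` more decisions are made. -/
def selectValue (π : Policy n) (i : Fin n) : ℕ → List (Fin n) → (Fin n → I) → ℝ
  | 0, _, _ => 0
  | k + 1, l, x =>
      ∑ j, π.prob l x (.inspect j) * π.selectValue i k (j :: l) x + π.prob l x (.take i)

/-- Expected discounted utility of the searcher when the boxes choose the distributions `F`;
the rewards are independent, and there are at most `n + 1` decisions. -/
def searcherUtility {μ : ℝ} (π : Policy n) (c β : ℝ) (F : Fin n → PureStrategy μ) : ℝ :=
  ∫ x, π.searcherValue c β (n + 1) [] x ∂Measure.pi fun i => (F i).law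

/-- Probability that box `i` is selected when the boxes choose the distributions `F`. -/
def selectProb {μ : ℝ} (π : Policy n) (F : Fin n → PureStrategy μ) (i : Fin n) : ℝ :=
  ∫ x, π.selectValue i (n + 1) [] x ∂Measure.pi fun i => (F i).law

/-- `π` maximizes the searcher's utility over all policies, against the distributions `F`. -/
def IsOptimal {μ : ℝ} (π : Policy n) (c β : ℝ) (F : Fin n → PureStrategy μ) : Prop :=
  ∀ π' : Policy n, π'.searcherUtility c β F ≤ π.searcherUtility c β F

/-- Fairness: at every history, all uninspected boxes whose reservation price is maximal among
the uninspected boxes are inspected next with the same probability, and all inspected boxes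
whose reward is maximal among the inspected boxes are taken with the same probability. -/
def IsFair {μ : ℝ} (π : Policy n) (c β : ℝ) (F : Fin n → PureStrategy μ) : Prop :=
  ∀ z : Fin n → ℝ, (∀ i, IsReservationPrice c β (F i) (z i)) →
  ∀ (l : List (Fin n)) (x : Fin n → I),
    (∀ i j, i ∉ l → j ∉ l → (∀ k, k ∉ l → z k ≤ z i) → (∀ k, k ∉ l → z k ≤ z j) →
      π.prob l x (.inspect i) = π.prob l x (.inspect j)) ∧
    (∀ i j, i ∈ l → j ∈ l → (∀ k ∈ l, x k ≤ x i) → (∀ k ∈ l, x k ≤ x j) →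
      π.prob l x (.take i) = π.prob l x (.take j))

end Policy

/-! ### Equilibrium -/

/-- Expected payoff of box `i`: the probability that it is selected when the boxes play the
mixed strategies `s` independently and the searcher answers a profile `F` by the policy `η F`.
(The integral is the lower integral, which is the expectation of the payoff whenever the payoff
is a measurable function of `F`; ties may be broken in a way that depends on `F` arbitrarily.) -/
def expectedPayoff {n : ℕ} {μ : ℝ} (η : (Fin n → PureStrategy μ) → Policy n)
    (s : Fin n → MixedStrategy μ) (i : Fin n) : ℝ≥0∞ :=
  ∫⁻ F, ENNReal.ofReal ((η F).selectProb F i) ∂Measure.pi fun j => (s j : Measure (PureStrategy μ))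

/-- Fair subgame perfect equilibrium: the searcher answers every profile of distributions by
a fair optimal policy, and no box gains by deviating to another mixed strategy. -/
structure IsFSPE {n : ℕ} {μ : ℝ} (c β : ℝ) (η : (Fin n → PureStrategy μ) → Policy n)
    (s : Fin n → MixedStrategy μ) : Prop where
  optimal : ∀ F, (η F).IsOptimal c β F
  fair : ∀ F, (η F).IsFair c β F
  best_response : ∀ (i : Fin n) (s' : MixedStrategy μ),
    expectedPayoff η (Function.update s i s') i ≤ expectedPayoff η s i

/-- All `n` boxes playing `s` is a (fair subgame perfect) equilibrium. -/
def IsSymmetricEquilibrium (n : ℕ) {μ : ℝ} (c β : ℝ) (s : MixedStrategy μ) : Prop :=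
  ∃ η : (Fin n → PureStrategy μ) → Policy n, IsFSPE c β η fun _ => s

/-- Search costs with frictions that are low enough for the searcher to search: `c ≥ 0`,
`0 < β ≤ 1`, `c > 0` and/or `β < 1`, and `β μ > c`. -/
structure Frictions (μ c β : ℝ) : Prop where
  cost_nonneg : 0 ≤ c
  discount_pos : 0 < β
  discount_le_one : β ≤ 1
  friction : 0 < c ∨ β < 1
  search : c < β * μ

end PandoraGame

end

/-!
The proof rests on a pathwise bound for the searcher. With `z i` the reservation price of box `i`,
the defining equation of `z i` says that the inspection cost `-c` has the same mean as the charge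
`(1 - β) z i - β (x i - z i)⁺`. A policy decides on an inspection before it sees the reward, so
replacing the cost by the charge leaves its utility unchanged (`Policy.searcherUtility_eq`). After
the replacement, the payoff is bounded at *every* profile `x` of rewards by the value of a
deterministic search problem in which box `i` holds the capped reward `min (x i) (z i)`
(`Policy.charged_le_pathBound`, `hindsight`). An exchange argument shows that Weitzman's index
policy attains this bound everywhere (`indexPolicy_tight`), so it is optimal. Consequently *every*
optimal policy attains the bound at almost every `x` (`Policy.IsOptimal.ae_tight`), and there the
box that is taken has the highest capped reward, and any inspected box whose reward exceeds its
price is the one taken (`Policy.tight_select`).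

The surplus from inspecting a box is convex in the value in hand, positive at `0` and negative at
`1`, so reservation prices exist, are unique and lie strictly between `0` and `1`. Comparing `x ↦
max x z` with its chord on `[0,1]` shows that the prior `G₀` strictly maximizes the reservation
price (`Frictions.resPrice_lt`).

Against fully revealing boxes, another strategy is selected only if they all turn out empty, which
has probability `(1 - μ) ^ (n - 1)`. The condition on the mean says that this is at most `1 / n`,
so that `G₀` is an equilibrium.

For uniqueness, in any profile some box gets at most `1 / n`. Let it deviate to `G₀`. If `m` boxes
then reveal fully, fairness makes the searcher inspect them first and in uniformly random order
until a prize is found, so each of them is selected with probability at least `(1 - (1 - μ) ^ m) /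
m`, and with probability at least `1 / n` if `m = n` (`Policy.IsOptimal.share_le_selectProb`). By
the condition on the mean this is never below `1 / n`, and for `m = 1` it is `μ > 1 / n`, which
makes the deviation profitable unless the common strategy is `G₀` almost surely. In the boundary
case `n = 2`, `μ = 1 / 2` one has `μ = 1 / n`; there a pure strategy other than `G₀` is beaten by
a signal whose good news falls slightly short of `1`, is therefore more likely than `μ`, and still
yields a higher reservation price (`Frictions.exists_likelier_news`). The claim for many boxes
follows, because `(1 - μ) ^ (n - 1) ≤ 1 / n` for all large `n`.
-/

namespace PandoraGame

/-! ### Independence of a coordinate under a product measure -/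

section Coordinate

variable {ι : Type*} [Fintype ι] [DecidableEq ι] {α : ι → Type*} [∀ i, MeasurableSpace (α i)]
  (ν : ∀ i, Measure (α i)) [∀ i, IsProbabilityMeasure (ν i)]

/-- Resampling one coordinate independently preserves a product of probability measures. -/
theorem measurePreserving_update (k : ι) :
    MeasurePreserving (fun p : (∀ i, α i) × α k => Function.update p.1 k p.2)
      ((Measure.pi ν).prod (ν k)) (Measure.pi ν) := by
  refine ⟨measurable_update', ?_⟩
  symm
  apply Measure.pi_eq
  intro s hs
  rw [Measure.map_apply measurable_update' (MeasurableSet.univ_pi hs)]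
  have : (fun p : (∀ i, α i) × α k => Function.update p.1 k p.2) ⁻¹' (Set.univ.pi s)
      = (Set.univ.pi (Function.update s k Set.univ)) ×ˢ s k := by
    ext ⟨x, t⟩
    simp only [Set.mem_preimage, Set.mem_pi, Set.mem_univ, true_implies, Set.mem_prod]
    constructor
    · intro h
      refine ⟨fun i => ?_, by simpa using h k⟩
      by_cases hi : i = k
      · subst hi; simp
      · simpa [hi] using h i
    · rintro ⟨h, ht⟩ i
      by_cases hi : i = k
      · subst hi; simpa using ht
      · simpa [hi] using h i
  rw [this, Measure.prod_prod, Measure.pi_pi]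
  rw [← Finset.mul_prod_erase Finset.univ _ (Finset.mem_univ k),
    ← Finset.mul_prod_erase Finset.univ (fun i => ν i (s i)) (Finset.mem_univ k)]
  simp only [Function.update_self, measure_univ, one_mul]
  rw [mul_comm]
  congr 1
  refine Finset.prod_congr rfl fun i hi => ?_
  rw [Function.update_of_ne (Finset.ne_of_mem_erase hi)]

variable {ν} in
theorem ae_ae_update {P : (∀ i, α i) → Prop} (h : ∀ᵐ x ∂Measure.pi ν, P x) (k : ι) :
    ∀ᵐ x ∂Measure.pi ν, ∀ᵐ t ∂ν k, P (Function.update x k t) :=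
  Measure.ae_ae_of_ae_prod ((measurePreserving_update ν k).quasiMeasurePreserving.ae h)

variable {ν} in
theorem integral_mul_coord_eq_zero {h : (∀ i, α i) → ℝ} {k : ι} {g : α k → ℝ}
    (hh : Measurable h) (hg : Measurable g) (hk : ∀ x t, h (Function.update x k t) = h x)
    (hg0 : ∫ t, g t ∂ν k = 0) : ∫ x, h x * g (x k) ∂Measure.pi ν = 0 := by
  have hm : Measurable fun x : ∀ i, α i => h x * g (x k) :=
    hh.mul (hg.comp (measurable_pi_apply k))
  rw [← (measurePreserving_update ν k).map_eq, integral_map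
    (measurePreserving_update ν k).measurable.aemeasurable hm.aestronglyMeasurable]
  simp only [hk, Function.update_self]
  rw [integral_prod_mul, hg0, mul_zero]

end Coordinate

/-! ### Bounded measurable functions -/

/-- Bounded measurable real functions. -/
structure BddMeas {X : Type*} [MeasurableSpace X] (f : X → ℝ) : Prop where
  measurable : Measurable f
  bdd : ∃ C, ∀ x, |f x| ≤ C

namespace BddMeas

variable {X : Type*} [MeasurableSpace X] {f g : X → ℝ}

theorem const (a : ℝ) : BddMeas fun _ : X => a := ⟨measurable_const, |a|, fun _ => le_rfl⟩

theorem add (hf : BddMeas f) (hg : BddMeas g) : BddMeas fun x => f x + g x := by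
  obtain ⟨C, hC⟩ := hf.bdd
  obtain ⟨D, hD⟩ := hg.bdd
  exact ⟨hf.measurable.add hg.measurable, C + D, fun x =>
    (abs_add_le _ _).trans (add_le_add (hC x) (hD x))⟩

theorem mul (hf : BddMeas f) (hg : BddMeas g) : BddMeas fun x => f x * g x := by
  obtain ⟨C, hC⟩ := hf.bdd
  obtain ⟨D, hD⟩ := hg.bdd
  refine ⟨hf.measurable.mul hg.measurable, C * D, fun x => ?_⟩
  rw [abs_mul]
  exact mul_le_mul (hC x) (hD x) (abs_nonneg _) ((abs_nonneg _).trans (hC x))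

theorem sum {ι : Type*} {s : Finset ι} {f : ι → X → ℝ} (hf : ∀ i ∈ s, BddMeas (f i)) :
    BddMeas fun x => ∑ i ∈ s, f i x := by
  classical
  induction s using Finset.induction_on with
  | empty => simpa using const (X := X) 0
  | insert a s ha ih =>
    simp only [Finset.sum_insert ha]
    exact (hf a (by simp)).add (ih fun i hi => hf i (by simp [hi]))

theorem of_mem_Icc {a b : ℝ} (hf : Measurable f) (h : ∀ x, a ≤ f x ∧ f x ≤ b) : BddMeas f :=
  ⟨hf, max |a| |b|, fun x => abs_le_max_abs_abs (h x).1 (h x).2⟩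

theorem integrable (hf : BddMeas f) (m : Measure X) [IsFiniteMeasure m] : Integrable f m := by
  obtain ⟨C, hC⟩ := hf.bdd
  exact Integrable.of_bound hf.measurable.aestronglyMeasurable C (Filter.Eventually.of_forall hC)

end BddMeas

/-! ### Reservation prices -/

variable {μ c β : ℝ}

namespace PureStrategy

theorem integral_law (F : PureStrategy μ) : ∫ x, (x : ℝ) ∂F.law = μ := F.2

theorem law_injective : Function.Injective (law (μ := μ)) := fun _ _ h =>
  Subtype.ext (Subtype.ext h)

theorem law_fullyRevealing (h0 : 0 ≤ μ) (h1 : μ ≤ 1) : (fullyRevealing μ h0 h1).law =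
    ENNReal.ofReal (1 - μ) • Measure.dirac (0 : I) + ENNReal.ofReal μ • Measure.dirac (1 : I) :=
  rfl

end PureStrategy

theorem integrable_max (F : PureStrategy μ) (z : ℝ) :
    Integrable (fun x : I => max (x : ℝ) z) F.law := by
  refine (BddMeas.of_mem_Icc (a := z) (b := max 1 z) (by fun_prop) fun x => ?_).integrable _
  exact ⟨le_max_right _ _, max_le_max_right _ x.2.2⟩

theorem integrable_coe (F : PureStrategy μ) : Integrable (fun x : I => (x : ℝ)) F.law :=
  (BddMeas.of_mem_Icc (a := 0) (b := 1) (by fun_prop) fun x => ⟨x.2.1, x.2.2⟩).integrable _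

/-- The gain of a searcher holding `z` from inspecting one more box, with distribution `F`. The
reservation price is its zero. -/
noncomputable def surplus (c β : ℝ) (F : PureStrategy μ) (z : ℝ) : ℝ :=
  -c + β * ∫ x, max (x : ℝ) z ∂F.law - z

theorem isReservationPrice_iff {F : PureStrategy μ} {z : ℝ} :
    IsReservationPrice c β F z ↔ surplus c β F z = 0 := by
  unfold IsReservationPrice surplus
  constructor <;> intro h <;> linarith

theorem surplus_of_nonpos (F : PureStrategy μ) {z : ℝ} (hz : z ≤ 0) :
    surplus c β F z = -c + β * μ - z := by
  unfold surplus
  have : ∀ x : I, max (x : ℝ) z = x := fun x => max_eq_left (hz.trans x.2.1)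
  simp only [this, F.integral_law]

theorem surplus_of_one_le (F : PureStrategy μ) {z : ℝ} (hz : 1 ≤ z) :
    surplus c β F z = -c + β * z - z := by
  unfold surplus
  have : ∀ x : I, max (x : ℝ) z = z := fun x => max_eq_right (x.2.2.trans hz)
  simp [this]

variable (H : Frictions μ c β)
include H

theorem Frictions.surplus_neg (F : PureStrategy μ) {z : ℝ} (hz : 1 ≤ z) :
    surplus c β F z < 0 := by
  rw [surplus_of_one_le F hz]
  have h1 := H.cost_nonneg
  have h2 := H.discount_le_one
  rcases H.friction with h | h <;> nlinarith

theorem Frictions.surplus_pos (F : PureStrategy μ) {z : ℝ} (hz : z ≤ 0) :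
    0 < surplus c β F z := by
  rw [surplus_of_nonpos F hz]
  linarith [H.search]

/-- Single crossing: the surplus is convex and negative at `1`. -/
theorem Frictions.surplus_pos_of_lt (F : PureStrategy μ) {z w : ℝ} (hzw : z < w)
    (hw : 0 ≤ surplus c β F w) : 0 < surplus c β F z := by
  have hw1 : w < 1 := by
    by_contra h
    linarith [H.surplus_neg F (not_lt.1 h)]
  have h1 := H.surplus_neg F le_rfl
  -- `w = (1 - t) z + t`
  set t := (w - z) / (1 - z) with ht
  have hz1 : 0 < 1 - z := by linarith
  have ht0 : 0 < t := div_pos (by linarith) hz1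
  have ht1 : t < 1 := (div_lt_one hz1).2 (by linarith)
  have hwt : w = (1 - t) * z + t := by rw [ht]; field_simp; ring
  have key : ∫ x, max (x : ℝ) w ∂F.law ≤
      ∫ x, ((1 - t) * max (x : ℝ) z + t * max (x : ℝ) 1) ∂F.law := by
    refine integral_mono (integrable_max F w)
      (((integrable_max F z).const_mul _).add ((integrable_max F 1).const_mul _)) fun x => ?_
    have e1 := le_max_left (x : ℝ) z
    have e2 := le_max_right (x : ℝ) z
    have e3 := le_max_left (x : ℝ) 1
    have e4 := le_max_right (x : ℝ) 1
    refine max_le ?_ ?_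
    · nlinarith
    · nlinarith
  rw [integral_add ((integrable_max F z).const_mul _) ((integrable_max F 1).const_mul _),
    integral_const_mul, integral_const_mul] at key
  have hβ := mul_le_mul_of_nonneg_left key H.discount_pos.le
  unfold surplus at *
  by_contra hneg
  nlinarith

omit H in
theorem continuous_surplus (F : PureStrategy μ) : Continuous (surplus c β F) := by
  unfold surplus
  have : Continuous fun z : ℝ => ∫ x, max (x : ℝ) z ∂F.law := by
    rw [continuous_iff_continuousAt]
    intro z₀
    refine continuousAt_of_dominated (bound := fun _ => |z₀| + 2) ?_ ?_ (integrable_const _) ?_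
    · exact Filter.Eventually.of_forall fun z => (integrable_max F z).1
    · filter_upwards [Metric.ball_mem_nhds z₀ one_pos] with z hz
      refine Filter.Eventually.of_forall fun x => ?_
      rw [Metric.mem_ball, Real.dist_eq] at hz
      have h1 := x.2.1
      have h2 := x.2.2
      have : |max (x : ℝ) z| ≤ max |(x : ℝ)| |z| := abs_max_le_max_abs_abs
      refine this.trans (max_le ?_ ?_)
      · rw [abs_of_nonneg h1]; linarith [abs_nonneg z₀]
      · have := abs_sub_abs_le_abs_sub z z₀
        linarith
    · exact Filter.Eventually.of_forall fun x => by fun_prop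
  fun_prop

theorem Frictions.existsUnique (F : PureStrategy μ) : ∃! z : ℝ, IsReservationPrice c β F z := by
  have hc : ContinuousOn (surplus c β F) (Set.Icc 0 1) := (continuous_surplus F).continuousOn
  have := intermediate_value_Icc' zero_le_one hc
  obtain ⟨z, -, hz⟩ := this ⟨(H.surplus_neg F le_rfl).le, (H.surplus_pos F le_rfl).le⟩
  refine ⟨z, isReservationPrice_iff.2 hz, fun w hw => ?_⟩
  replace hw : surplus c β F w = 0 := isReservationPrice_iff.1 hw
  rcases lt_trichotomy w z with h | h | h
  · linarith [H.surplus_pos_of_lt F h hz.ge]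
  · exact h
  · linarith [H.surplus_pos_of_lt F h hw.ge]

omit H in
/-- The reservation price of `F`; it is meaningful under `Frictions`, where it is unique. -/
noncomputable def resPrice (c β : ℝ) (F : PureStrategy μ) : ℝ :=
  Classical.epsilon fun z => IsReservationPrice c β F z

theorem Frictions.isReservationPrice (F : PureStrategy μ) :
    IsReservationPrice c β F (resPrice c β F) :=
  Classical.epsilon_spec (H.existsUnique F).exists

theorem Frictions.eq_resPrice {F : PureStrategy μ} {z : ℝ} (h : IsReservationPrice c β F z) :
    z = resPrice c β F := (H.existsUnique F).unique h (H.isReservationPrice F)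

theorem Frictions.surplus_resPrice (F : PureStrategy μ) : surplus c β F (resPrice c β F) = 0 :=
  isReservationPrice_iff.1 (H.isReservationPrice F)

theorem Frictions.lt_resPrice {F : PureStrategy μ} {z : ℝ} (h : 0 < surplus c β F z) :
    z < resPrice c β F := by
  by_contra hn
  rcases (not_lt.1 hn).eq_or_lt with e | e
  · rw [← e, H.surplus_resPrice] at h
    exact lt_irrefl _ h
  · linarith [H.surplus_pos_of_lt F e h.le, H.surplus_resPrice F]

theorem Frictions.resPrice_pos (F : PureStrategy μ) : 0 < resPrice c β F :=
  H.lt_resPrice (H.surplus_pos F le_rfl)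

theorem Frictions.resPrice_lt_one (F : PureStrategy μ) : resPrice c β F < 1 := by
  by_contra h
  linarith [H.surplus_neg F (not_lt.1 h), H.surplus_resPrice F]

/-- The change of the searcher's payoff that replaces the inspection cost by the charge
`(1 - β) z - β (x - z)⁺` has mean zero. -/
theorem Frictions.integral_charge (F : PureStrategy μ) :
    ∫ x : I, ((1 - β) * resPrice c β F - β * max ((x : ℝ) - resPrice c β F) 0 + c) ∂F.law = 0 := by
  have h := H.surplus_resPrice F
  set z := resPrice c β F
  have e : ∀ x : I, (1 - β) * z - β * max ((x : ℝ) - z) 0 + c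
      = (z + c) - β * max (x : ℝ) z := fun x => by
    have : max (x : ℝ) z = max ((x : ℝ) - z) 0 + z := by
      rw [← max_add_add_right]; simp
    rw [this]; ring
  simp only [e]
  rw [integral_sub (integrable_const _) ((integrable_max F z).const_mul _), integral_const_mul]
  unfold surplus at h
  simp
  linarith

theorem Frictions.measure_gt_resPrice_pos (F : PureStrategy μ) :
    0 < F.law {x : I | resPrice c β F < x} := by
  rw [pos_iff_ne_zero]
  intro h0
  have hz := H.surplus_resPrice F
  set z := resPrice c β F
  have hz0 : 0 < z := H.resPrice_pos F
  have : ∫ x, max (x : ℝ) z ∂F.law = z := by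
    have : (fun x : I => max (x : ℝ) z) =ᵐ[F.law] fun _ => z := by
      rw [Filter.EventuallyEq, ae_iff]
      refine measure_mono_null (fun x hx => ?_) h0
      by_contra hx'
      exact hx (max_eq_right (not_lt.1 hx'))
    rw [integral_congr_ae this]; simp
  unfold surplus at hz
  rw [this] at hz
  have h1 := H.cost_nonneg
  have h2 := H.discount_le_one
  rcases H.friction with h | h <;> nlinarith

omit H in
theorem integral_fullyRevealing (h0 : 0 ≤ μ) (h1 : μ ≤ 1) (f : I → ℝ) :
    ∫ x, f x ∂(PureStrategy.fullyRevealing μ h0 h1).law = (1 - μ) * f 0 + μ * f 1 := by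
  have hint : ∀ a : I, Integrable f (Measure.dirac a) := fun a => integrable_dirac (by simp)
  rw [PureStrategy.law_fullyRevealing, integral_add_measure
    ((hint 0).smul_measure ENNReal.ofReal_ne_top) ((hint 1).smul_measure ENNReal.ofReal_ne_top)]
  simp [h0, h1]

omit H in
/-- A distribution on `[0,1]` with no mass in the interior is the prior. -/
theorem eq_fullyRevealing_of_ae (h0 : 0 ≤ μ) (h1 : μ ≤ 1) (F : PureStrategy μ)
    (h : ∀ᵐ x ∂F.law, x = 0 ∨ x = 1) : F = PureStrategy.fullyRevealing μ h0 h1 := by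
  have hm : F.law {1} = ENNReal.ofReal μ := by
    have e : (fun x : I => (x : ℝ)) =ᵐ[F.law] Set.indicator {1} (fun _ => (1 : ℝ)) := by
      filter_upwards [h] with x hx
      rcases hx with rfl | rfl <;> simp
    have := integral_congr_ae e
    rw [F.integral_law, integral_indicator_const _ (measurableSet_singleton _)] at this
    simp only [Measure.real, smul_eq_mul, mul_one] at this
    rw [← ENNReal.ofReal_toReal (measure_ne_top F.law {1}), ← this]
  have hm0 : F.law {0} = ENNReal.ofReal (1 - μ) := by
    have hc : F.law {0} = F.law ({1}ᶜ) := by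
      refine measure_congr ?_
      filter_upwards [h] with x hx
      apply propext
      change x = 0 ↔ ¬ (x = 1)
      rcases hx with rfl | rfl <;> simp
    rw [hc, prob_compl_eq_one_sub (measurableSet_singleton _), hm,
      ENNReal.ofReal_sub _ h0, ENNReal.ofReal_one]
  apply PureStrategy.law_injective
  rw [PureStrategy.law_fullyRevealing]
  ext s hs
  have hs' : F.law s = F.law (s ∩ {0}) + F.law (s ∩ {1}) := by
    rw [← measure_union (by
      rw [Set.disjoint_left]; rintro x ⟨-, hx⟩ ⟨-, hx'⟩
      rw [Set.mem_singleton_iff] at hx hx'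
      rw [hx] at hx'; exact zero_ne_one hx') (hs.inter (measurableSet_singleton _)),
      ← Set.inter_union_distrib_left]
    refine measure_congr ?_
    filter_upwards [h] with x hx
    apply propext
    change x ∈ s ↔ (x ∈ s ∧ (x = 0 ∨ x = 1))
    tauto
  have hone : ∀ a : I, F.law (s ∩ {a}) = F.law {a} * s.indicator 1 a := by
    intro a
    by_cases ha : a ∈ s
    · rw [Set.inter_eq_right.2 (Set.singleton_subset_iff.2 ha)]; simp [ha]
    · have : s ∩ {a} = ∅ := by
        ext x; simp only [Set.mem_inter_iff, Set.mem_singleton_iff, Set.mem_empty_iff_false,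
          iff_false]
        rintro ⟨h1, rfl⟩; exact ha h1
      simp [this, ha]
  simp [hs', hone, hm, hm0, hs]

/-- The prior is the strict maximizer of the reservation price: a convex function of the posterior
mean lies below its chord, which only a distribution on the two end points attains in mean. -/
theorem Frictions.resPrice_lt (h0 : 0 < μ) (h1 : μ ≤ 1) {F : PureStrategy μ}
    (hF : F ≠ PureStrategy.fullyRevealing μ h0.le h1) :
    resPrice c β F < resPrice c β (PureStrategy.fullyRevealing μ h0.le h1) := by
  apply H.lt_resPrice
  have hz := H.surplus_resPrice F
  have hz0 := H.resPrice_pos F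
  have hz1 := H.resPrice_lt_one F
  set z := resPrice c β F
  set g : I → ℝ := fun x => z + x * (1 - z) - max (x : ℝ) z with hg
  have hg0 : ∀ x, 0 ≤ g x := fun x => by
    have a1 := x.2.1
    have a2 := x.2.2
    rw [hg]; simp only [sub_nonneg]
    exact max_le (by nlinarith) (by nlinarith)
  have hgi : Integrable g F.law :=
    ((integrable_const _).add ((integrable_coe F).mul_const _)).sub (integrable_max F z)
  have hint : ∫ x, g x ∂F.law = z + μ * (1 - z) - ∫ x, max (x : ℝ) z ∂F.law := by
    have i1 : Integrable (fun x : I => z + x * (1 - z)) F.law :=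
      (integrable_const _).add ((integrable_coe F).mul_const _)
    rw [hg, integral_sub i1 (integrable_max F z),
      integral_add (integrable_const _) ((integrable_coe F).mul_const _),
      integral_mul_const, F.integral_law]
    simp
  have hpos : 0 < ∫ x, g x ∂F.law := by
    rcases (integral_nonneg (μ := F.law) (f := g) hg0).lt_or_eq with h | h
    · exact h
    · exfalso
      apply hF
      apply eq_fullyRevealing_of_ae
      have := (integral_eq_zero_iff_of_nonneg hg0 hgi).1 h.symm
      filter_upwards [this] with x hx
      have hx' : z + x * (1 - z) - max (x : ℝ) z = 0 := hx
      rcases le_total (x : ℝ) z with hxz | hxz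
      · left
        rw [max_eq_right hxz] at hx'
        have : (x : ℝ) * (1 - z) = 0 := by linarith
        rcases mul_eq_zero.1 this with h | h
        · exact Subtype.ext h
        · linarith
      · right
        rw [max_eq_left hxz] at hx'
        have : z * (1 - x) = 0 := by linarith
        rcases mul_eq_zero.1 this with h | h
        · linarith
        · exact Subtype.ext (show (x : ℝ) = 1 by linarith)
  unfold surplus at hz ⊢
  rw [integral_fullyRevealing]
  have e0 : max ((0 : I) : ℝ) z = z := max_eq_right (by simpa using hz0.le)
  have e1 : max ((1 : I) : ℝ) z = 1 := max_eq_left (by simpa using hz1.le)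
  rw [e0, e1]
  have := mul_pos H.discount_pos (hint ▸ hpos)
  nlinarith

end PandoraGame

namespace PandoraGame

/-! ### The search problem with known rewards -/

section Hindsight

variable {ι : Type*} [DecidableEq ι] (β : ℝ) (z κ : ι → ℝ)

/-- Auxiliary form of `hindsight`, with a bound on the number of inspections. -/
noncomputable def hindsightAux : ℕ → Finset ι → ℝ → ℝ
  | 0, _, m => m
  | k + 1, U, m =>
    U.fold max m fun i => (1 - β) * z i + β * hindsightAux k (U.erase i) (max m (κ i))

/-- The value of a deterministic search problem: with the boxes in `U` uninspected and `m` in hand,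
either stop with `m`, or collect `(1 - β) z i` for inspecting some `i ∈ U`, whose known reward is
`κ i`, and go on one period later. -/
noncomputable def hindsight (U : Finset ι) (m : ℝ) : ℝ := hindsightAux β z κ U.card U m

theorem hindsight_eq (U : Finset ι) (m : ℝ) : hindsight β z κ U m =
    U.fold max m fun i => (1 - β) * z i + β * hindsight β z κ (U.erase i) (max m (κ i)) := by
  unfold hindsight
  rcases hU : U.card with _ | k
  · rw [Finset.card_eq_zero] at hU
    subst hU; simp [hindsightAux]
  · rw [hindsightAux]
    refine Finset.fold_congr fun i hi => ?_
    rw [Finset.card_erase_of_mem hi, hU, Nat.add_sub_cancel]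

theorem le_hindsight (U : Finset ι) (m : ℝ) : m ≤ hindsight β z κ U m := by
  rw [hindsight_eq, Finset.le_fold_max]
  exact Or.inl le_rfl

theorem step_le_hindsight {U : Finset ι} {i : ι} (hi : i ∈ U) (m : ℝ) :
    (1 - β) * z i + β * hindsight β z κ (U.erase i) (max m (κ i)) ≤ hindsight β z κ U m := by
  rw [hindsight_eq _ _ _ U, Finset.le_fold_max]
  exact Or.inr ⟨i, hi, le_rfl⟩

theorem hindsight_le {U : Finset ι} {m b : ℝ} (hm : m ≤ b) (h : ∀ i ∈ U,
    (1 - β) * z i + β * hindsight β z κ (U.erase i) (max m (κ i)) ≤ b) :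
    hindsight β z κ U m ≤ b := by
  rw [hindsight_eq, Finset.fold_max_le]
  exact ⟨hm, h⟩

variable {β z κ} (hβ1 : β ≤ 1) (hκ : ∀ i, κ i ≤ z i)
include hβ1 hκ

theorem hindsight_of_le (U : Finset ι) (m : ℝ) (h : ∀ i ∈ U, z i ≤ m) :
    hindsight β z κ U m = m := by
  induction U using Finset.strongInduction with
  | H U ih =>
    refine le_antisymm (hindsight_le _ _ _ le_rfl fun i hi => ?_) (le_hindsight _ _ _ _ _)
    rw [max_eq_left ((hκ i).trans (h i hi)), ih _ (Finset.erase_ssubset hi)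
      fun j hj => h j (Finset.mem_of_mem_erase hj)]
    nlinarith [h i hi]

/-- Exchange argument: the box with the highest `z` comes first, unless the search stops. -/
theorem hindsight_of_ge (hβ0 : 0 ≤ β) (U : Finset ι) (m : ℝ) {i : ι} (hi : i ∈ U)
    (hmax : ∀ j ∈ U, z j ≤ z i) (hm : m ≤ z i) : hindsight β z κ U m =
      (1 - β) * z i + β * hindsight β z κ (U.erase i) (max m (κ i)) := by
  induction U using Finset.strongInduction generalizing m with
  | H U ih =>
    refine le_antisymm (hindsight_le _ _ _ ?_ fun j hj => ?_) (step_le_hindsight _ _ _ hi m)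
    · have h1 := le_hindsight β z κ (U.erase i) (max m (κ i))
      have h2 := le_max_left m (κ i)
      nlinarith [hβ1]
    · by_cases hij : j = i
      · rw [hij]
      · have hi' : i ∈ U.erase j := Finset.mem_erase.2 ⟨Ne.symm hij, hi⟩
        have hj' : j ∈ U.erase i := Finset.mem_erase.2 ⟨hij, hj⟩
        rw [ih (U.erase j) (Finset.erase_ssubset hj) (max m (κ j)) hi'
          (fun k hk => hmax k (Finset.mem_of_mem_erase hk))
          (max_le hm ((hκ j).trans (hmax j hj)))]
        have h1 := step_le_hindsight β z κ hj' (max m (κ i))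
        rw [Finset.erase_right_comm, max_right_comm] at h1
        have h2 := hmax j hj
        have h3 := mul_le_mul_of_nonneg_left h1 hβ0
        nlinarith [mul_nonneg (sub_nonneg.2 hβ1) (mul_nonneg (sub_nonneg.2 hβ1) (sub_nonneg.2 h2))]

end Hindsight

theorem le_of_hindsight_eq {ι : Type*} [DecidableEq ι] {β : ℝ} {z κ : ι → ℝ} (hβ0 : 0 < β)
    (hβ1 : β ≤ 1) (hκ : ∀ i, κ i ≤ z i) {U : Finset ι} {m : ℝ}
    (h : hindsight β z κ U m = m) {i : ι} (hi : i ∈ U) : κ i ≤ m := by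
  by_contra hlt
  have hlt := not_le.1 hlt
  have h1 := step_le_hindsight β z κ hi m
  rw [h] at h1
  have h2 := le_hindsight β z κ (U.erase i) (max m (κ i))
  rw [max_eq_right hlt.le] at h1 h2
  nlinarith [hκ i, mul_le_mul_of_nonneg_left h2 hβ0.le,
    mul_le_mul_of_nonneg_left (hκ i) (sub_nonneg.2 hβ1)]

end PandoraGame

namespace PandoraGame

variable {n : ℕ}

/-! ### Capped rewards and the pathwise bound -/

section Path

variable (β : ℝ) (z : Fin n → ℝ) (x : Fin n → I)

/-- The reward of box `i`, capped at the price `z i`. -/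
noncomputable def capped (i : Fin n) : ℝ := min (x i : ℝ) (z i)

/-- The part of the reward of box `i` above the price `z i`. -/
noncomputable def excess (i : Fin n) : ℝ := max ((x i : ℝ) - z i) 0

/-- The best capped reward of the boxes in `l`, or the outside option `0` if that is better. -/
noncomputable def bestCapped : List (Fin n) → ℝ
  | [] => 0
  | i :: l => max (bestCapped l) (capped z x i)

/-- The sum of the excesses of the boxes in `l`. -/
noncomputable def totalExcess (l : List (Fin n)) : ℝ := (l.map (excess z x)).sum

/-- The boxes that are not in `l`. -/
def uninspected (l : List (Fin n)) : Finset (Fin n) := Finset.univ.filter (· ∉ l)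

/-- An upper bound for the payoff after the history `l`, when the rewards are `x` and inspections
are paid for by the charge of `Policy.charged`. -/
noncomputable def pathBound (l : List (Fin n)) : ℝ :=
  hindsight β z (capped z x) (uninspected l) (bestCapped z x l) + totalExcess z x l

variable {β z x}

theorem capped_le (i : Fin n) : capped z x i ≤ z i := min_le_right _ _

theorem capped_le_coe (i : Fin n) : capped z x i ≤ x i := min_le_left _ _

theorem excess_nonneg (i : Fin n) : 0 ≤ excess z x i := le_max_right _ _

theorem capped_add_excess (i : Fin n) : capped z x i + excess z x i = x i := by
  unfold capped excess
  rcases le_total (x i : ℝ) (z i) with h | h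
  · rw [min_eq_left h, max_eq_right (by linarith)]; ring
  · rw [min_eq_right h, max_eq_left (by linarith)]; ring

theorem excess_pos {i : Fin n} (h : z i < x i) : 0 < excess z x i :=
  lt_max_of_lt_left (sub_pos.2 h)

theorem excess_eq_zero {i : Fin n} (h : (x i : ℝ) ≤ z i) : excess z x i = 0 :=
  max_eq_right (sub_nonpos.2 h)

theorem mem_uninspected {l : List (Fin n)} {i : Fin n} : i ∈ uninspected l ↔ i ∉ l := by
  simp [uninspected]

theorem uninspected_cons (i : Fin n) (l : List (Fin n)) :
    uninspected (i :: l) = (uninspected l).erase i := by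
  ext j; simp [uninspected]

theorem bestCapped_nonneg (l : List (Fin n)) : 0 ≤ bestCapped z x l := by
  induction l with
  | nil => exact le_rfl
  | cons i l ih => exact ih.trans (le_max_left _ _)

theorem capped_le_bestCapped {l : List (Fin n)} {i : Fin n} (hi : i ∈ l) :
    capped z x i ≤ bestCapped z x l := by
  induction l with
  | nil => simp at hi
  | cons j l ih =>
    rcases List.mem_cons.1 hi with rfl | h
    · exact le_max_right _ _
    · exact (ih h).trans (le_max_left _ _)

theorem bestCapped_le {l : List (Fin n)} {b : ℝ} (hb : 0 ≤ b) (h : ∀ i ∈ l, capped z x i ≤ b) :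
    bestCapped z x l ≤ b := by
  induction l with
  | nil => exact hb
  | cons j l ih => exact max_le (ih fun i hi => h i (by simp [hi])) (h j (by simp))

@[simp]
theorem totalExcess_nil : totalExcess z x [] = 0 := rfl

@[simp]
theorem totalExcess_cons (i : Fin n) (l : List (Fin n)) :
    totalExcess z x (i :: l) = excess z x i + totalExcess z x l := rfl

theorem totalExcess_nonneg (l : List (Fin n)) : 0 ≤ totalExcess z x l := by
  induction l with
  | nil => simp
  | cons i l ih => rw [totalExcess_cons]; linarith [excess_nonneg (z := z) (x := x) i]

theorem totalExcess_eq_zero {l : List (Fin n)} (h : ∀ i ∈ l, (x i : ℝ) ≤ z i) :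
    totalExcess z x l = 0 := by
  induction l with
  | nil => simp
  | cons i l ih =>
    rw [totalExcess_cons, excess_eq_zero (h i (by simp)), ih fun j hj => h j (by simp [hj])]
    ring

theorem excess_le_totalExcess {l : List (Fin n)} {i : Fin n} (hi : i ∈ l) :
    excess z x i ≤ totalExcess z x l := by
  induction l with
  | nil => simp at hi
  | cons j l ih =>
    rw [totalExcess_cons]
    rcases List.mem_cons.1 hi with rfl | h
    · linarith [totalExcess_nonneg (z := z) (x := x) l]
    · linarith [ih h, excess_nonneg (z := z) (x := x) j]

theorem excess_add_excess_le {l : List (Fin n)} {i j : Fin n} (hi : i ∈ l) (hj : j ∈ l)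
    (hij : i ≠ j) : excess z x i + excess z x j ≤ totalExcess z x l := by
  induction l with
  | nil => simp at hi
  | cons k l ih =>
    rw [totalExcess_cons]
    rcases List.mem_cons.1 hi with rfl | h
    · rcases List.mem_cons.1 hj with rfl | h'
      · exact absurd rfl hij
      · linarith [excess_le_totalExcess (z := z) (x := x) h']
    · rcases List.mem_cons.1 hj with rfl | h'
      · linarith [excess_le_totalExcess (z := z) (x := x) h]
      · linarith [ih h h', excess_nonneg (z := z) (x := x) k]

theorem pathBound_nonneg (l : List (Fin n)) : 0 ≤ pathBound β z x l :=
  add_nonneg ((bestCapped_nonneg l).trans (le_hindsight _ _ _ _ _)) (totalExcess_nonneg l)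

theorem coe_le_pathBound {l : List (Fin n)} {i : Fin n} (hi : i ∈ l) :
    (x i : ℝ) ≤ pathBound β z x l := by
  rw [← capped_add_excess (z := z)]
  exact add_le_add ((capped_le_bestCapped hi).trans (le_hindsight _ _ _ _ _))
    (excess_le_totalExcess hi)

theorem inspect_le_pathBound (hβ1 : β ≤ 1) {l : List (Fin n)} {i : Fin n} (hi : i ∉ l) :
    (1 - β) * z i - β * excess z x i + β * pathBound β z x (i :: l) ≤ pathBound β z x l := by
  have h := step_le_hindsight β z (capped z x) (mem_uninspected.2 hi) (bestCapped z x l)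
  have hS := totalExcess_nonneg (z := z) (x := x) l
  unfold pathBound
  rw [totalExcess_cons, uninspected_cons]
  change (1 - β) * z i - β * excess z x i + β * (hindsight β z (capped z x) _
    (max (bestCapped z x l) (capped z x i)) + _) ≤ _
  nlinarith

end Path

namespace Policy

/-! ### Elementary facts about policies -/

section Basic

variable (π : Policy n) (l : List (Fin n)) (x : Fin n → I)

theorem prob_le_one (a : Action n) : π.prob l x a ≤ 1 := by
  have h1 : 0 ≤ ∑ i, π.prob l x (.inspect i) := Finset.sum_nonneg fun i _ => π.prob_nonneg _ _ _
  have h2 : 0 ≤ ∑ i, π.prob l x (.take i) := Finset.sum_nonneg fun i _ => π.prob_nonneg _ _ _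
  have h3 := π.prob_nonneg l x .quit
  have h4 := π.prob_sum l x
  cases a with
  | inspect i =>
    have := Finset.single_le_sum (f := fun i => π.prob l x (.inspect i))
      (fun i _ => π.prob_nonneg _ _ _) (Finset.mem_univ i)
    linarith
  | take i =>
    have := Finset.single_le_sum (f := fun i => π.prob l x (.take i))
      (fun i _ => π.prob_nonneg _ _ _) (Finset.mem_univ i)
    linarith
  | quit => linarith

theorem bddMeas_prob (a : Action n) : BddMeas fun x => π.prob l x a :=
  .of_mem_Icc (π.measurable_prob l a) fun x => ⟨π.prob_nonneg l x a, π.prob_le_one l x a⟩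

theorem bddMeas_coe (i : Fin n) : BddMeas fun x : Fin n → I => (x i : ℝ) :=
  .of_mem_Icc (a := 0) (b := 1) (by fun_prop) fun x => ⟨(x i).2.1, (x i).2.2⟩

theorem bddMeas_searcherValue (c β : ℝ) (k : ℕ) (l : List (Fin n)) :
    BddMeas (π.searcherValue c β k l) := by
  induction k generalizing l with
  | zero => exact .const 0
  | succ k ih =>
    exact (BddMeas.sum fun i _ => (π.bddMeas_prob l _).mul ((BddMeas.const _).add
      ((BddMeas.const _).mul (ih _)))).add
      (.sum fun i _ => (π.bddMeas_prob l _).mul (bddMeas_coe i))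

theorem bddMeas_selectValue (j : Fin n) (k : ℕ) (l : List (Fin n)) :
    BddMeas (π.selectValue j k l) := by
  induction k generalizing l with
  | zero => exact .const 0
  | succ k ih =>
    exact (BddMeas.sum fun i _ => (π.bddMeas_prob l _).mul (ih _)).add (π.bddMeas_prob l _)

theorem selectValue_nonneg (j : Fin n) (k : ℕ) (l : List (Fin n)) :
    0 ≤ π.selectValue j k l x := by
  induction k generalizing l with
  | zero => exact le_rfl
  | succ k ih =>
    exact add_nonneg (Finset.sum_nonneg fun i _ => mul_nonneg (π.prob_nonneg _ _ _) (ih _))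
      (π.prob_nonneg _ _ _)

theorem sum_selectValue_succ (k : ℕ) : ∑ j, π.selectValue j (k + 1) l x =
    ∑ i, π.prob l x (.inspect i) * ∑ j, π.selectValue j k (i :: l) x
      + ∑ j, π.prob l x (.take j) := by
  simp only [selectValue, Finset.sum_add_distrib, Finset.mul_sum]
  rw [Finset.sum_comm]

theorem sum_selectValue_le_one (k : ℕ) (l : List (Fin n)) :
    ∑ j, π.selectValue j k l x ≤ 1 := by
  induction k generalizing l with
  | zero => simp [selectValue]
  | succ k ih =>
    rw [sum_selectValue_succ, ← π.prob_sum l x]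
    have : ∑ i, π.prob l x (.inspect i) * ∑ j, π.selectValue j k (i :: l) x
        ≤ ∑ i, π.prob l x (.inspect i) := Finset.sum_le_sum fun i _ =>
      mul_le_of_le_one_right (π.prob_nonneg _ _ _) (ih _)
    linarith [π.prob_nonneg l x .quit]

theorem selectValue_le_one (j : Fin n) (k : ℕ) : π.selectValue j k l x ≤ 1 :=
  (Finset.single_le_sum (f := fun j => π.selectValue j k l x)
    (fun _ _ => π.selectValue_nonneg _ _ _ _) (Finset.mem_univ j)).trans
    (π.sum_selectValue_le_one x k l)

/-- A searcher who does not quit takes a box in the end. -/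
theorem sum_selectValue_eq_one (k : ℕ) {l : List (Fin n)} (hl : l.Nodup) (hk : n + 1 ≤ k + l.length)
    (hq : π.prob [] x .quit = 0) : ∑ j, π.selectValue j k l x = 1 := by
  induction k generalizing l with
  | zero =>
    have := hl.length_le_card
    rw [Fintype.card_fin] at this
    omega
  | succ k ih =>
    have hq' : π.prob l x .quit = 0 := by
      by_cases h : l = []
      · rw [h, hq]
      · exact π.quit_legal l x h
    rw [sum_selectValue_succ, ← π.prob_sum l x, hq', add_zero]
    congr 1
    refine Finset.sum_congr rfl fun i _ => ?_
    by_cases hi : i ∈ l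
    · rw [π.inspect_legal l x i hi, zero_mul]
    · rw [ih (List.nodup_cons.2 ⟨hi, hl⟩) (by rw [List.length_cons]; omega), mul_one]

/-- Probability, over the randomization of the policy, that the history `l` is reached, when the
rewards in the boxes are `x`. -/
noncomputable def reach : List (Fin n) → (Fin n → I) → ℝ
  | [], _ => 1
  | i :: l, x => reach l x * π.prob l x (.inspect i)

theorem reach_nonneg : 0 ≤ π.reach l x := by
  induction l with
  | nil => exact zero_le_one
  | cons i l ih => exact mul_nonneg ih (π.prob_nonneg _ _ _)

variable {π l x}

theorem reach_congr {y : Fin n → I} (h : ∀ i ∈ l, x i = y i) : π.reach l x = π.reach l y := by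
  induction l with
  | nil => rfl
  | cons i l ih =>
    have h' : ∀ j ∈ l, x j = y j := fun j hj => h j (by simp [hj])
    rw [reach, reach, ih h', π.adapted l x y _ h']

theorem reach_cons_pos {i : Fin n} : 0 < π.reach (i :: l) x ↔
    0 < π.reach l x ∧ 0 < π.prob l x (.inspect i) := by
  rw [reach]
  constructor
  · intro h
    have h1 := π.reach_nonneg l x
    have h2 := π.prob_nonneg l x (.inspect i)
    constructor
    · exact lt_of_le_of_ne h1 fun e => by rw [← e] at h; simp at h
    · exact lt_of_le_of_ne h2 fun e => by rw [← e] at h; simp at h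
  · rintro ⟨h1, h2⟩
    exact mul_pos h1 h2

theorem notMem_of_inspect_pos {i : Fin n} (h : 0 < π.prob l x (.inspect i)) : i ∉ l := fun hi =>
  h.ne' (π.inspect_legal l x i hi)

theorem mem_of_take_pos {i : Fin n} (h : 0 < π.prob l x (.take i)) : i ∈ l := by
  by_contra hi
  exact h.ne' (π.take_legal l x i hi)

theorem nodup_of_reach_pos (h : 0 < π.reach l x) : l.Nodup := by
  induction l with
  | nil => exact List.nodup_nil
  | cons i l ih =>
    rw [reach_cons_pos] at h
    exact List.nodup_cons.2 ⟨notMem_of_inspect_pos h.2, ih h.1⟩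

end Basic

/-! ### Charging for inspections -/

/-- The payoff of the searcher if the cost of inspecting box `i` is replaced by the payment
`(1 - β) z i - β (x i - z i)⁺`, which has the same mean when `z i` is the reservation price. -/
noncomputable def charged (π : Policy n) (β : ℝ) (z : Fin n → ℝ) :
    ℕ → List (Fin n) → (Fin n → I) → ℝ
  | 0, _, _ => 0
  | k + 1, l, x =>
      ∑ i, π.prob l x (.inspect i) *
          ((1 - β) * z i - β * excess z x i + β * π.charged β z k (i :: l) x)
        + ∑ i, π.prob l x (.take i) * (x i : ℝ)

theorem bddMeas_excess (z : Fin n → ℝ) (i : Fin n) : BddMeas fun x => excess z x i := by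
  refine .of_mem_Icc (a := 0) (b := max (1 - z i) 0) (by unfold excess; fun_prop) fun x =>
    ⟨excess_nonneg i, ?_⟩
  exact max_le_max_right _ (by linarith [(x i).2.2])

theorem bddMeas_charged (π : Policy n) (β : ℝ) (z : Fin n → ℝ) (k : ℕ) (l : List (Fin n)) :
    BddMeas (π.charged β z k l) := by
  induction k generalizing l with
  | zero => exact .const 0
  | succ k ih =>
    have h : ∀ i, BddMeas fun x => (1 - β) * z i - β * excess z x i := fun i => by
      have := (BddMeas.const ((1 - β) * z i)).add
        ((BddMeas.const (-β)).mul (bddMeas_excess z i))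
      simpa only [neg_mul, ← sub_eq_add_neg] using this
    exact (BddMeas.sum fun i _ => (π.bddMeas_prob l _).mul ((h i).add
      ((BddMeas.const _).mul (ih _)))).add
      (.sum fun i _ => (π.bddMeas_prob l _).mul (bddMeas_coe i))

theorem charged_le_pathBound (π : Policy n) {β : ℝ} (hβ0 : 0 ≤ β) (hβ1 : β ≤ 1) (z : Fin n → ℝ)
    (k : ℕ) (l : List (Fin n)) (x : Fin n → I) : π.charged β z k l x ≤ pathBound β z x l := by
  induction k generalizing l with
  | zero => exact pathBound_nonneg l
  | succ k ih =>
    calc π.charged β z (k + 1) l x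
        ≤ ∑ i, π.prob l x (.inspect i) * pathBound β z x l
          + ∑ i, π.prob l x (.take i) * pathBound β z x l := by
          refine add_le_add (Finset.sum_le_sum fun i _ => ?_) (Finset.sum_le_sum fun i _ => ?_)
          · by_cases hi : i ∈ l
            · rw [π.inspect_legal l x i hi, zero_mul, zero_mul]
            · refine mul_le_mul_of_nonneg_left ?_ (π.prob_nonneg _ _ _)
              linarith [inspect_le_pathBound (z := z) (x := x) hβ1 hi,
                mul_le_mul_of_nonneg_left (ih (i :: l)) hβ0]
          · by_cases hi : i ∈ l
            · exact mul_le_mul_of_nonneg_left (coe_le_pathBound hi) (π.prob_nonneg _ _ _)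
            · rw [π.take_legal l x i hi, zero_mul, zero_mul]
      _ = (1 - π.prob l x .quit) * pathBound β z x l := by
          rw [← Finset.sum_mul, ← Finset.sum_mul, ← add_mul]
          congr 1
          linarith [π.prob_sum l x]
      _ ≤ pathBound β z x l :=
          mul_le_of_le_one_left (pathBound_nonneg l) (by linarith [π.prob_nonneg l x .quit])

/-- Where the bound is attained, every action in the support of the policy attains it. -/
theorem tight_of_charged_eq (π : Policy n) {β : ℝ} (hβ0 : 0 < β) (hβ1 : β ≤ 1) {z : Fin n → ℝ}
    {k : ℕ} {l : List (Fin n)} {x : Fin n → I}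
    (h : π.charged β z (k + 1) l x = pathBound β z x l) :
    (∀ i, 0 < π.prob l x (.inspect i) →
      π.charged β z k (i :: l) x = pathBound β z x (i :: l)) ∧
    (∀ i, 0 < π.prob l x (.take i) → (x i : ℝ) = pathBound β z x l) ∧
    (0 < π.prob l x .quit → pathBound β z x l = 0) := by
  set B := pathBound β z x l with hB
  have h1 : ∀ i ∈ Finset.univ, 0 ≤ π.prob l x (.inspect i) * (B - ((1 - β) * z i -
      β * excess z x i + β * π.charged β z k (i :: l) x)) := fun i _ => by
    by_cases hi : i ∈ l
    · rw [π.inspect_legal l x i hi, zero_mul]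
    · refine mul_nonneg (π.prob_nonneg _ _ _) ?_
      linarith [inspect_le_pathBound (z := z) (x := x) hβ1 hi,
        mul_le_mul_of_nonneg_left (π.charged_le_pathBound hβ0.le hβ1 z k (i :: l) x) hβ0.le]
  have h2 : ∀ i ∈ Finset.univ, 0 ≤ π.prob l x (.take i) * (B - x i) := fun i _ => by
    by_cases hi : i ∈ l
    · exact mul_nonneg (π.prob_nonneg _ _ _) (sub_nonneg.2 (coe_le_pathBound hi))
    · rw [π.take_legal l x i hi, zero_mul]
  have h3 : 0 ≤ π.prob l x .quit * B := mul_nonneg (π.prob_nonneg _ _ _) (pathBound_nonneg l)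
  have hsum : ∑ i, π.prob l x (.inspect i) * (B - ((1 - β) * z i -
      β * excess z x i + β * π.charged β z k (i :: l) x)) +
      ∑ i, π.prob l x (.take i) * (B - x i) + π.prob l x .quit * B = 0 := by
    simp only [mul_sub (π.prob l x _) B, Finset.sum_sub_distrib, ← Finset.sum_mul]
    have := congrArg (· * B) (π.prob_sum l x)
    rw [charged] at h
    simp only [add_mul, one_mul] at this
    linarith
  have s1 := Finset.sum_nonneg h1
  have s2 := Finset.sum_nonneg h2
  have z1 := (Finset.sum_eq_zero_iff_of_nonneg h1).1 (by linarith)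
  have z2 := (Finset.sum_eq_zero_iff_of_nonneg h2).1 (by linarith)
  refine ⟨fun i hi => ?_, fun i hi => ?_, fun hq => ?_⟩
  · have e := (mul_eq_zero.1 (z1 i (Finset.mem_univ i))).resolve_left hi.ne'
    refine le_antisymm (π.charged_le_pathBound hβ0.le hβ1 z k _ x) ?_
    have := inspect_le_pathBound (z := z) (x := x) hβ1 (notMem_of_inspect_pos hi)
    exact le_of_mul_le_mul_left (by linarith) hβ0
  · exact (sub_eq_zero.1 ((mul_eq_zero.1 (z2 i (Finset.mem_univ i))).resolve_left hi.ne')).symm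
  · have e : π.prob l x .quit * B = 0 := by linarith
    exact (mul_eq_zero.1 e).resolve_left hq.ne'

theorem tight_of_reach_pos (π : Policy n) {β : ℝ} (hβ0 : 0 < β) (hβ1 : β ≤ 1) {z : Fin n → ℝ}
    {x : Fin n → I} (h : π.charged β z (n + 1) [] x = pathBound β z x []) {l : List (Fin n)}
    (hl : 0 < π.reach l x) {k : ℕ} (hk : k + l.length = n + 1) :
    π.charged β z k l x = pathBound β z x l := by
  induction l generalizing k with
  | nil => rw [List.length_nil, add_zero] at hk; rw [hk, h]
  | cons i l ih =>
    rw [reach_cons_pos] at hl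
    exact (π.tight_of_charged_eq hβ0 hβ1
      (ih hl.1 (k := k + 1) (by rw [List.length_cons] at hk; omega))).1 i hl.2

theorem tight_take (π : Policy n) {β : ℝ} (hβ0 : 0 < β) (hβ1 : β ≤ 1) {z : Fin n → ℝ}
    {x : Fin n → I} {k : ℕ} {l : List (Fin n)}
    (h : π.charged β z (k + 1) l x = pathBound β z x l) {j : Fin n}
    (hj : 0 < π.prob l x (.take j)) :
    (∀ i, capped z x i ≤ capped z x j) ∧ (∀ i ∈ l, 0 < excess z x i → i = j) := by
  have hB := (π.tight_of_charged_eq hβ0 hβ1 h).2.1 j hj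
  have hjl := mem_of_take_pos hj
  rw [← capped_add_excess (z := z), pathBound] at hB
  have h1 := capped_le_bestCapped (z := z) (x := x) hjl
  have h2 := le_hindsight β z (capped z x) (uninspected l) (bestCapped z x l)
  have h3 := excess_le_totalExcess (z := z) (x := x) hjl
  refine ⟨fun i => ?_, fun i hi hpos => ?_⟩
  · have e : bestCapped z x l = capped z x j := by linarith
    by_cases hi : i ∈ l
    · rw [← e]; exact capped_le_bestCapped hi
    · rw [← e]
      exact le_of_hindsight_eq hβ0 hβ1 capped_le (by linarith) (mem_uninspected.2 hi)
  · by_contra hij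
    linarith [excess_add_excess_le (z := z) (x := x) hi hjl hij]

/-- Where the bound is attained, the box that is taken has the highest capped reward, and every
inspected box whose reward exceeds its price is taken. -/
theorem tight_select (π : Policy n) {β : ℝ} (hβ0 : 0 < β) (hβ1 : β ≤ 1) {z : Fin n → ℝ}
    {x : Fin n → I} {k : ℕ} {l : List (Fin n)}
    (h : π.charged β z k l x = pathBound β z x l) {j : Fin n}
    (hj : 0 < π.selectValue j k l x) :
    (∀ i, capped z x i ≤ capped z x j) ∧ (∀ i ∈ l, 0 < excess z x i → i = j) := by
  induction k generalizing l with
  | zero => simp [selectValue] at hj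
  | succ k ih =>
    by_cases ht : 0 < π.prob l x (.take j)
    · exact π.tight_take hβ0 hβ1 h ht
    · have ht0 := le_antisymm (not_lt.1 ht) (π.prob_nonneg _ _ _)
      rw [selectValue, ht0, add_zero] at hj
      obtain ⟨i, -, hi⟩ := Finset.exists_lt_of_sum_lt (s := Finset.univ) (f := fun _ => (0 : ℝ))
        (by simpa using hj)
      have hp : 0 < π.prob l x (.inspect i) := lt_of_le_of_ne (π.prob_nonneg _ _ _) fun e => by
        rw [← e] at hi; simp at hi
      have hs : 0 < π.selectValue j k (i :: l) x := pos_of_mul_pos_right hi hp.le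
      obtain ⟨a, b⟩ := ih ((π.tight_of_charged_eq hβ0 hβ1 h).1 i hp) hs
      exact ⟨a, fun i' hi' => b i' (by simp [hi'])⟩

variable {μ c β : ℝ}

/-- The charges do not change the expected payoff, because a policy decides on inspecting a box
before it sees the reward in it. -/
theorem integral_mul_charged_sub (H : Frictions μ c β) (F : Fin n → PureStrategy μ) (π : Policy n)
    (k : ℕ) (l : List (Fin n)) {w : (Fin n → I) → ℝ} (hw : BddMeas w)
    (hwl : ∀ x y, (∀ i ∈ l, x i = y i) → w x = w y) :
    ∫ x, w x * (π.charged β (fun i => resPrice c β (F i)) k l x - π.searcherValue c β k l x)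
      ∂(Measure.pi fun i => (F i).law) = 0 := by
  induction k generalizing l w with
  | zero => simp [charged, searcherValue]
  | succ k ih =>
    set z : Fin n → ℝ := fun i => resPrice c β (F i) with hz
    set d : Fin n → I → ℝ := fun i t => (1 - β) * z i - β * max ((t : ℝ) - z i) 0 + c with hd
    have hdm : ∀ i, Measurable (d i) := fun i => by rw [hd]; fun_prop
    have hdb : ∀ i, BddMeas fun x : Fin n → I => d i (x i) := fun i => by
      have := (BddMeas.const ((1 - β) * z i + c)).add
        ((BddMeas.const (-β)).mul (bddMeas_excess z i))
      convert this using 2 with x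
      simp only [hd, excess]; ring
    have hD : ∀ l, BddMeas fun x => π.charged β z k l x - π.searcherValue c β k l x := fun l => by
      have := (π.bddMeas_charged β z k l).add
        ((BddMeas.const (-1)).mul (π.bddMeas_searcherValue c β k l))
      convert this using 2 with x
      ring
    have hwp : ∀ i, BddMeas fun x => w x * π.prob l x (.inspect i) := fun i =>
      hw.mul (π.bddMeas_prob l _)
    have e : ∀ x, w x * (π.charged β z (k + 1) l x - π.searcherValue c β (k + 1) l x) =
        ∑ i, ((w x * π.prob l x (.inspect i)) * d i (x i) + β * ((w x * π.prob l x (.inspect i)) *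
          (π.charged β z k (i :: l) x - π.searcherValue c β k (i :: l) x))) := fun x => by
      rw [charged, searcherValue, add_sub_add_right_eq_sub, ← Finset.sum_sub_distrib,
        Finset.mul_sum]
      refine Finset.sum_congr rfl fun i _ => ?_
      simp only [hd, excess]; ring
    have i1 := fun i => ((hwp i).mul (hdb i)).integrable (Measure.pi fun i => (F i).law)
    have i2 := fun i => (((hwp i).mul (hD (i :: l))).integrable
      (Measure.pi fun i => (F i).law)).const_mul β
    simp only [e]
    rw [integral_finsetSum]
    swap
    · exact fun i _ => (i1 i).add (i2 i)
    refine Finset.sum_eq_zero fun i _ => ?_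
    rw [integral_add (i1 i) (i2 i), integral_const_mul, ih (i :: l) (hwp i) ?_, mul_zero, add_zero]
    · by_cases hi : i ∈ l
      · simp [π.inspect_legal l _ i hi]
      · refine integral_mul_coord_eq_zero (hwp i).measurable (hdm i) (fun x t => ?_)
          (H.integral_charge (F i))
        have : ∀ j ∈ l, Function.update x i t j = x j := fun j hj =>
          Function.update_of_ne (fun (e : j = i) => hi (e ▸ hj)) _ _
        rw [hwl _ _ this, π.adapted l _ _ _ this]
    · intro x y hxy
      have : ∀ j ∈ l, x j = y j := fun j hj => hxy j (by simp [hj])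
      rw [hwl x y this, π.adapted l x y _ this]

theorem searcherUtility_eq (H : Frictions μ c β) (F : Fin n → PureStrategy μ) (π : Policy n) :
    π.searcherUtility c β F = ∫ x, π.charged β (fun i => resPrice c β (F i)) (n + 1) [] x
      ∂(Measure.pi fun i => (F i).law) := by
  have h := π.integral_mul_charged_sub H F (n + 1) [] (BddMeas.const 1) (fun _ _ _ => rfl)
  simp only [one_mul] at h
  rw [integral_sub ((π.bddMeas_charged _ _ _ _).integrable _)
    ((π.bddMeas_searcherValue _ _ _ _).integrable _)] at h
  unfold searcherUtility
  linarith

/-- A policy that attains the pathwise bound is optimal. -/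
theorem isOptimal_of_tight (H : Frictions μ c β) (F : Fin n → PureStrategy μ) {π : Policy n}
    (h : ∀ x, π.charged β (fun i => resPrice c β (F i)) (n + 1) [] x =
      pathBound β (fun i => resPrice c β (F i)) x []) : π.IsOptimal c β F := fun π' => by
  rw [searcherUtility_eq H, searcherUtility_eq H]
  refine integral_mono ((bddMeas_charged _ _ _ _ _).integrable _)
    ((bddMeas_charged _ _ _ _ _).integrable _) fun x => ?_
  rw [h]
  exact π'.charged_le_pathBound H.discount_pos.le H.discount_le_one _ _ _ _

/-- If some policy attains the pathwise bound, every optimal policy does so almost surely. -/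
theorem ae_tight_of_isOptimal (H : Frictions μ c β) (F : Fin n → PureStrategy μ) {π π₀ : Policy n}
    (h₀ : ∀ x, π₀.charged β (fun i => resPrice c β (F i)) (n + 1) [] x =
      pathBound β (fun i => resPrice c β (F i)) x []) (hπ : π.IsOptimal c β F) :
    ∀ᵐ x ∂(Measure.pi fun i => (F i).law),
      π.charged β (fun i => resPrice c β (F i)) (n + 1) [] x =
      pathBound β (fun i => resPrice c β (F i)) x [] := by
  have h := hπ π₀
  rw [searcherUtility_eq H, searcherUtility_eq H] at h
  have i1 := (π.bddMeas_charged β (fun i => resPrice c β (F i)) (n + 1) []).integrable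
    (Measure.pi fun i => (F i).law)
  have i2 := (π₀.bddMeas_charged β (fun i => resPrice c β (F i)) (n + 1) []).integrable
    (Measure.pi fun i => (F i).law)
  have hle : ∀ x, π.charged β (fun i => resPrice c β (F i)) (n + 1) [] x ≤
      π₀.charged β (fun i => resPrice c β (F i)) (n + 1) [] x := fun x => by
    rw [h₀]
    exact π.charged_le_pathBound H.discount_pos.le H.discount_le_one _ _ _ _
  have heq := (integral_eq_iff_of_ae_le i1 i2 (Filter.Eventually.of_forall hle)).1
    (le_antisymm (integral_mono i1 i2 hle) h)
  filter_upwards [heq] with x hx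
  rw [hx, h₀]

end Policy

end PandoraGame

namespace PandoraGame

variable {n : ℕ}

/-! ### The index policy -/

section Index

open Classical in
/-- Weight `1` on the members of a set given by a predicate and `0` elsewhere, normalized to sum
to `1` if the predicate holds somewhere. -/
noncomputable def uniformOn (p : Fin n → Prop) (i : Fin n) : ℝ :=
  (if p i then 1 else 0) / ∑ k, if p k then 1 else 0

theorem uniformOn_nonneg (p : Fin n → Prop) (i : Fin n) : 0 ≤ uniformOn p i := by
  unfold uniformOn
  refine div_nonneg ?_ (Finset.sum_nonneg fun k _ => ?_) <;> split_ifs <;> simp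

theorem uniformOn_eq_zero {p : Fin n → Prop} {i : Fin n} (h : ¬ p i) : uniformOn p i = 0 := by
  simp [uniformOn, h]

theorem sum_uniformOn {p : Fin n → Prop} {i : Fin n} (h : p i) : ∑ j, uniformOn p j = 1 := by
  classical
  unfold uniformOn
  rw [← Finset.sum_div]
  apply div_self
  have := Finset.single_le_sum (f := fun k => if p k then (1 : ℝ) else 0)
    (fun k _ => by split_ifs <;> simp) (Finset.mem_univ i)
  simp only [h, if_true] at this
  have h2 : (0 : ℝ) < ∑ k, if p k then (1 : ℝ) else 0 := by linarith
  convert h2.ne'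

theorem uniformOn_congr {p : Fin n → Prop} {i j : Fin n} (hi : p i) (hj : p j) :
    uniformOn p i = uniformOn p j := by
  simp [uniformOn, hi, hj]

theorem measurable_uniformOn {p : (Fin n → I) → Fin n → Prop}
    (hp : ∀ i, MeasurableSet {x | p x i}) (i : Fin n) : Measurable fun x => uniformOn (p x) i := by
  classical
  unfold uniformOn
  refine (Measurable.ite (hp i) measurable_const measurable_const).div ?_
  exact Finset.measurable_sum _ fun k _ => Measurable.ite (hp k) measurable_const measurable_const

variable (z : Fin n → ℝ)

/-- Search goes on at a history if some uninspected box has a price above all rewards seen. -/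
def Continues (l : List (Fin n)) (x : Fin n → I) : Prop := ∃ i, i ∉ l ∧ ∀ j ∈ l, (x j : ℝ) < z i

/-- The uninspected boxes with the highest price, at the histories where search goes on. -/
def NextBox (l : List (Fin n)) (x : Fin n → I) (i : Fin n) : Prop :=
  Continues z l x ∧ i ∉ l ∧ ∀ k, k ∉ l → z k ≤ z i

/-- The inspected boxes with the highest reward, at the histories where search stops. -/
def FinalBox (l : List (Fin n)) (x : Fin n → I) (i : Fin n) : Prop :=
  ¬ Continues z l x ∧ i ∈ l ∧ ∀ k ∈ l, x k ≤ x i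

theorem measurableSet_continues (l : List (Fin n)) : MeasurableSet {x | Continues z l x} := by
  have : {x : Fin n → I | Continues z l x} =
      ⋃ i : Fin n, {x | i ∉ l} ∩ ⋂ j : Fin n, {x | j ∈ l → (x j : ℝ) < z i} := by
    ext x; simp [Continues]
  rw [this]
  refine MeasurableSet.iUnion fun i => (MeasurableSet.const _).inter
    (MeasurableSet.iInter fun j => ?_)
  by_cases hj : j ∈ l
  · simp only [hj, true_implies]
    exact measurableSet_lt (by fun_prop) measurable_const
  · simp [hj]

theorem measurableSet_finalBox (l : List (Fin n)) (i : Fin n) :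
    MeasurableSet {x | FinalBox z l x i} := by
  have : {x : Fin n → I | FinalBox z l x i} = {x | Continues z l x}ᶜ ∩ ({x | i ∈ l} ∩
      ⋂ j : Fin n, {x | j ∈ l → x j ≤ x i}) := by
    ext x; simp [FinalBox]
  rw [this]
  refine (measurableSet_continues z l).compl.inter ((MeasurableSet.const _).inter
    (MeasurableSet.iInter fun j => ?_))
  by_cases hj : j ∈ l
  · simp only [hj, true_implies]
    exact measurableSet_le (measurable_pi_apply j) (measurable_pi_apply i)
  · simp [hj]

variable {z} in
theorem continues_congr {l : List (Fin n)} {x y : Fin n → I} (h : ∀ i ∈ l, x i = y i) :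
    Continues z l x ↔ Continues z l y := by
  unfold Continues
  refine exists_congr fun i => and_congr_right fun _ => forall₂_congr fun j hj => ?_
  rw [h j hj]

variable {z} in
theorem exists_nextBox {l : List (Fin n)} {x : Fin n → I} (h : Continues z l x) :
    ∃ i, NextBox z l x i := by
  obtain ⟨i, hi, -⟩ := id h
  obtain ⟨j, hj, hmax⟩ := Finset.exists_max_image (uninspected l) z ⟨i, mem_uninspected.2 hi⟩
  exact ⟨j, h, mem_uninspected.1 hj, fun k hk => hmax k (mem_uninspected.2 hk)⟩

variable {z} in
theorem exists_finalBox {l : List (Fin n)} {x : Fin n → I} (h : ¬ Continues z l x)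
    (hl : l ≠ []) : ∃ i, FinalBox z l x i := by
  obtain ⟨j, hj, hmax⟩ := Finset.exists_max_image l.toFinset x
    ((List.toFinset_nonempty_iff l).2 hl)
  exact ⟨j, h, List.mem_toFinset.1 hj, fun k hk => hmax k (List.mem_toFinset.2 hk)⟩

open Classical in
/-- The index policy for the prices `z`: inspect a box with the highest price as long as it
exceeds all rewards seen, then take a box with the highest reward; ties are broken evenly. -/
noncomputable def indexPolicy : Policy n where
  prob l x
    | .inspect i => uniformOn (NextBox z l x) i
    | .take i => uniformOn (FinalBox z l x) i
    | .quit => if ¬ Continues z l x ∧ l = [] then 1 else 0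
  prob_nonneg l x a := by
    cases a with
    | inspect i => exact uniformOn_nonneg _ _
    | take i => exact uniformOn_nonneg _ _
    | quit => dsimp only; split_ifs <;> simp
  prob_sum l x := by
    by_cases h : Continues z l x
    · obtain ⟨i, hi⟩ := exists_nextBox h
      have h0 : ∀ j, uniformOn (FinalBox z l x) j = 0 := fun j =>
        uniformOn_eq_zero fun hj => hj.1 h
      simp [sum_uniformOn hi, h0, h]
    · have h0 : ∀ j, uniformOn (NextBox z l x) j = 0 := fun j =>
        uniformOn_eq_zero fun hj => h hj.1
      by_cases hl : l = []
      · have h1 : ∀ j, uniformOn (FinalBox z l x) j = 0 := fun j =>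
          uniformOn_eq_zero fun hj => by simpa [hl] using hj.2.1
        simp only [h0, h1]
        rw [if_pos ⟨h, hl⟩]
        simp
      · obtain ⟨i, hi⟩ := exists_finalBox h hl
        simp [sum_uniformOn hi, h0, hl]
  inspect_legal l x i hi := uniformOn_eq_zero fun h => h.2.1 hi
  take_legal l x i hi := uniformOn_eq_zero fun h => hi h.2.1
  quit_legal l x hl := by simp [hl]
  adapted l x y a h := by
    have h1 : NextBox z l x = NextBox z l y := by
      ext i; exact and_congr_left fun _ => continues_congr h
    have h2 : FinalBox z l x = FinalBox z l y := by
      ext i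
      refine and_congr (not_congr (continues_congr h)) (and_congr_right fun hi =>
        forall₂_congr fun k hk => ?_)
      rw [h k hk, h i hi]
    cases a with
    | inspect i => dsimp only; rw [h1]
    | take i => dsimp only; rw [h2]
    | quit => dsimp only; simp only [continues_congr (z := z) h]
  measurable_prob l a := by
    cases a with
    | inspect i =>
      refine measurable_uniformOn (fun i => ?_) i
      exact (measurableSet_continues z l).inter (MeasurableSet.const _)
    | take i => exact measurable_uniformOn (measurableSet_finalBox z l) i
    | quit =>
      exact Measurable.ite ((measurableSet_continues z l).compl.inter (MeasurableSet.const _))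
        measurable_const measurable_const

variable {z}

theorem indexPolicy_isFair {μ c β : ℝ} (H : Frictions μ c β) (F : Fin n → PureStrategy μ) :
    (indexPolicy fun i => resPrice c β (F i)).IsFair c β F := by
  intro w hw l x
  obtain rfl : w = fun i => resPrice c β (F i) := funext fun i => H.eq_resPrice (hw i)
  refine ⟨fun i j hi hj hmi hmj => ?_, fun i j hi hj hmi hmj => ?_⟩
  · by_cases h : Continues (fun i => resPrice c β (F i)) l x
    · exact uniformOn_congr ⟨h, hi, hmi⟩ ⟨h, hj, hmj⟩
    · exact (uniformOn_eq_zero fun hn => h hn.1).trans (uniformOn_eq_zero fun hn => h hn.1).symm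
  · by_cases h : Continues (fun i => resPrice c β (F i)) l x
    · exact (uniformOn_eq_zero fun hn => hn.1 h).trans (uniformOn_eq_zero fun hn => hn.1 h).symm
    · exact uniformOn_congr ⟨h, hi, hmi⟩ ⟨h, hj, hmj⟩

/-- The histories that the index policy reaches: boxes are inspected in the order of their
prices, and all rewards but the latest one were below the price of the latest box. -/
structure IndexHistory (z : Fin n → ℝ) (x : Fin n → I) (l : List (Fin n)) : Prop where
  price_le : ∀ j ∈ l, ∀ i, i ∉ l → z i ≤ z j
  tail_lt : ∀ j l', l = j :: l' → ∀ i ∈ l', (x i : ℝ) < z j ∧ z j ≤ z i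

theorem IndexHistory.cons {x : Fin n → I} {l : List (Fin n)} (h : IndexHistory z x l) {i : Fin n}
    (hi : NextBox z l x i) : IndexHistory z x (i :: l) := by
  refine ⟨fun j hj k hk => ?_, fun j l' e k hk => ?_⟩
  · have hk' : k ∉ l := fun h' => hk (by simp [h'])
    rcases List.mem_cons.1 hj with rfl | hj
    · exact hi.2.2 k hk'
    · exact h.price_le j hj k hk'
  · obtain ⟨rfl, rfl⟩ := List.cons.inj e
    obtain ⟨m, hm, hlt⟩ := hi.1
    exact ⟨(hlt k hk).trans_le (hi.2.2 m hm), h.price_le k hk _ hi.2.1⟩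

/-- When the index policy stops, its payoff is the pathwise bound. -/
theorem IndexHistory.coe_eq_pathBound {β : ℝ} (hβ1 : β ≤ 1) {x : Fin n → I} {l : List (Fin n)}
    (hz0 : ∀ i, 0 ≤ z i) (h : IndexHistory z x l) {i : Fin n} (hi : FinalBox z l x i) :
    (x i : ℝ) = pathBound β z x l := by
  obtain ⟨hdone, hil, hmax⟩ := hi
  have hmax' : ∀ k ∈ l, (x k : ℝ) ≤ x i := hmax
  have hz : ∀ k, k ∉ l → z k ≤ x i := fun k hk => by
    by_contra hlt
    exact hdone ⟨k, hk, fun j hj => (hmax' j hj).trans_lt (not_le.1 hlt)⟩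
  have hcap : ∀ k, k ∉ l → z k ≤ capped z x i := fun k hk =>
    le_min (hz k hk) (h.price_le i hil k hk)
  -- only the box inspected last may have a positive excess, and then it is the box `i`
  have hex : totalExcess z x l = excess z x i := by
    rcases l with _ | ⟨j, l'⟩
    · simp at hil
    · have ht := h.tail_lt j l' rfl
      rw [totalExcess_cons, totalExcess_eq_zero fun k hk => (ht k hk).1.le.trans (ht k hk).2,
        add_zero]
      rcases List.mem_cons.1 hil with rfl | hi'
      · rfl
      · rw [excess_eq_zero ((ht i hi').1.le.trans (ht i hi').2),
          excess_eq_zero ((hmax' j (by simp)).trans (ht i hi').1.le)]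
  have hcap' : ∀ k ∈ l, capped z x k ≤ capped z x i := fun k hk => by
    rcases l with _ | ⟨j, l'⟩
    · simp at hk
    · have ht := h.tail_lt j l' rfl
      rcases List.mem_cons.1 hil with rfl | hi'
      · rcases List.mem_cons.1 hk with rfl | hk'
        · exact le_rfl
        · exact le_min ((capped_le_coe k).trans (hmax' k hk))
            ((capped_le_coe k).trans (ht k hk').1.le)
      · exact le_min ((capped_le_coe k).trans (hmax' k hk))
          ((capped_le_coe k).trans ((hmax' k hk).trans ((ht i hi').1.le.trans (ht i hi').2)))
  have hbest : bestCapped z x l = capped z x i :=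
    le_antisymm (bestCapped_le (le_min (x i).2.1 (hz0 i)) hcap') (capped_le_bestCapped hil)
  rw [pathBound, hex, hbest, hindsight_of_le hβ1 capped_le _ _ fun k hk =>
    hcap k (mem_uninspected.1 hk), capped_add_excess]

/-- While the index policy continues, its inspections stay on the pathwise bound. -/
theorem IndexHistory.inspect_eq_pathBound {β : ℝ} (hβ0 : 0 ≤ β) (hβ1 : β ≤ 1) {x : Fin n → I}
    {l : List (Fin n)} (hz0 : ∀ i, 0 ≤ z i) (h : IndexHistory z x l) {i : Fin n}
    (hi : NextBox z l x i) :
    (1 - β) * z i - β * excess z x i + β * pathBound β z x (i :: l) = pathBound β z x l := by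
  obtain ⟨⟨m, hm, hlt⟩, hil, hmax⟩ := hi
  have hS : totalExcess z x l = 0 := totalExcess_eq_zero fun j hj =>
    (hlt j hj).le.trans (h.price_le j hj m hm)
  have hB : bestCapped z x l ≤ z i := bestCapped_le (hz0 i) fun j hj =>
    (capped_le_coe j).trans ((hlt j hj).le.trans (hmax m hm))
  rw [pathBound, pathBound, totalExcess_cons, hS, uninspected_cons,
    hindsight_of_ge hβ1 capped_le hβ0 (uninspected l) _ (mem_uninspected.2 hil)
      (fun j hj => hmax j (mem_uninspected.1 hj)) hB]
  rw [bestCapped]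
  ring

theorem indexPolicy_charged {β : ℝ} (hβ0 : 0 ≤ β) (hβ1 : β ≤ 1) (hz0 : ∀ i, 0 ≤ z i) (hn : 0 < n)
    (x : Fin n → I) (k : ℕ) {l : List (Fin n)} (h : IndexHistory z x l) (hl : l.Nodup)
    (hk : n + 1 ≤ k + l.length) :
    (indexPolicy z).charged β z k l x = pathBound β z x l := by
  induction k generalizing l with
  | zero =>
    have := hl.length_le_card
    rw [Fintype.card_fin] at this
    omega
  | succ k ih =>
    have e1 : ∀ i, (indexPolicy z).prob l x (.inspect i) = uniformOn (NextBox z l x) i :=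
      fun _ => rfl
    have e2 : ∀ i, (indexPolicy z).prob l x (.take i) = uniformOn (FinalBox z l x) i :=
      fun _ => rfl
    simp only [Policy.charged, e1, e2]
    by_cases hc : Continues z l x
    · obtain ⟨i₀, hi₀⟩ := exists_nextBox hc
      have h2 : ∀ i, uniformOn (FinalBox z l x) i * (x i : ℝ) = 0 := fun i => by
        rw [uniformOn_eq_zero fun hf => hf.1 hc, zero_mul]
      have h1 : ∀ i, uniformOn (NextBox z l x) i * ((1 - β) * z i - β * excess z x i +
          β * (indexPolicy z).charged β z k (i :: l) x) =
          uniformOn (NextBox z l x) i * pathBound β z x l := fun i => by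
        by_cases hi : NextBox z l x i
        · rw [ih (h.cons hi) (List.nodup_cons.2 ⟨hi.2.1, hl⟩) (by rw [List.length_cons]; omega),
            h.inspect_eq_pathBound hβ0 hβ1 hz0 hi]
        · rw [uniformOn_eq_zero hi, zero_mul, zero_mul]
      simp only [h1, h2, Finset.sum_const_zero, add_zero, ← Finset.sum_mul, sum_uniformOn hi₀,
        one_mul]
    · have hne : l ≠ [] := by
        rintro rfl
        exact hc ⟨⟨0, hn⟩, by simp, by simp⟩
      obtain ⟨i₀, hi₀⟩ := exists_finalBox hc hne
      have h1 : ∀ i, uniformOn (NextBox z l x) i = 0 := fun i =>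
        uniformOn_eq_zero fun hf => hc hf.1
      have h2 : ∀ i, uniformOn (FinalBox z l x) i * (x i : ℝ) =
          uniformOn (FinalBox z l x) i * pathBound β z x l := fun i => by
        by_cases hi : FinalBox z l x i
        · rw [← h.coe_eq_pathBound hβ1 hz0 hi]
        · rw [uniformOn_eq_zero hi, zero_mul, zero_mul]
      simp only [h1, h2, zero_mul, Finset.sum_const_zero, zero_add, ← Finset.sum_mul,
        sum_uniformOn hi₀, one_mul]

theorem indexPolicy_tight {μ c β : ℝ} (H : Frictions μ c β) (hn : 0 < n)
    (F : Fin n → PureStrategy μ) (x : Fin n → I) :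
    (indexPolicy fun i => resPrice c β (F i)).charged β (fun i => resPrice c β (F i)) (n + 1) [] x =
      pathBound β (fun i => resPrice c β (F i)) x [] :=
  indexPolicy_charged H.discount_pos.le H.discount_le_one (fun i => (H.resPrice_pos (F i)).le) hn x
    (n + 1) ⟨by simp, by simp⟩ List.nodup_nil (by simp)

end Index

end PandoraGame

namespace PandoraGame

variable {n : ℕ} {μ c β : ℝ}

/-! ### Optimal policies on almost every profile of rewards -/

theorem exists_mem_of_ae {X : Type*} [MeasurableSpace X] {m : Measure X} {P : X → Prop}
    (h : ∀ᵐ t ∂m, P t) {s : Set X} (hs : m s ≠ 0) : ∃ t ∈ s, P t := by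
  by_contra! hne
  exact hs (measure_mono_null (fun t ht => hne t ht) (ae_iff.1 h))

namespace Policy

/-- The policy attains the pathwise bound at the rewards `x`. -/
def Tight (π : Policy n) (c β : ℝ) (F : Fin n → PureStrategy μ) (x : Fin n → I) : Prop :=
  π.charged β (fun i => resPrice c β (F i)) (n + 1) [] x =
    pathBound β (fun i => resPrice c β (F i)) x []

variable {π : Policy n} {F : Fin n → PureStrategy μ}

theorem IsOptimal.ae_tight (hπ : π.IsOptimal c β F) (H : Frictions μ c β) (hn : 0 < n) :
    ∀ᵐ x ∂Measure.pi fun i => (F i).law, π.Tight c β F x :=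
  ae_tight_of_isOptimal H F (indexPolicy_tight H hn F) hπ

/-- An optimal policy never declines to search. -/
theorem IsOptimal.quit_eq_zero (hπ : π.IsOptimal c β F) (H : Frictions μ c β) (hn : 0 < n)
    (x : Fin n → I) : π.prob [] x .quit = 0 := by
  by_contra hq
  obtain ⟨y, hy⟩ := (ae_ae_update (hπ.ae_tight H hn) ⟨0, hn⟩).exists
  obtain ⟨t, ht, htight⟩ := exists_mem_of_ae hy (H.measure_gt_resPrice_pos (F ⟨0, hn⟩)).ne'
  set x' := Function.update y ⟨0, hn⟩ t
  have hq' : 0 < π.prob [] x' .quit := by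
    rw [π.adapted [] x' x .quit (by simp)]
    exact lt_of_le_of_ne (π.prob_nonneg _ _ _) (Ne.symm hq)
  have h0 := (π.tight_of_charged_eq H.discount_pos H.discount_le_one htight).2.2 hq'
  rw [pathBound, totalExcess_nil, add_zero] at h0
  have := le_of_hindsight_eq H.discount_pos H.discount_le_one capped_le h0
    (mem_uninspected.2 (List.not_mem_nil (a := ⟨0, hn⟩)))
  have hz := H.resPrice_pos (F ⟨0, hn⟩)
  have ht' : resPrice c β (F ⟨0, hn⟩) < t := ht
  have : 0 < capped (fun i => resPrice c β (F i)) x' ⟨0, hn⟩ := by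
    refine lt_min ?_ hz
    simp only [x', Function.update_self]
    linarith
  simp only [bestCapped] at *
  linarith

theorem Tight.selectValue_eq_zero {x : Fin n → I} (h : π.Tight c β F x) (H : Frictions μ c β)
    {i j : Fin n} (hij : capped (fun i => resPrice c β (F i)) x j <
      capped (fun i => resPrice c β (F i)) x i) : π.selectValue j (n + 1) [] x = 0 := by
  by_contra hne
  have := (π.tight_select H.discount_pos H.discount_le_one h
    (lt_of_le_of_ne (π.selectValue_nonneg _ _ _ _) (Ne.symm hne))).1 i
  linarith

/-- A box with the highest reservation price is selected at least when its reward exceeds the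
reservation prices of all other boxes. -/
theorem IsOptimal.le_selectProb (hπ : π.IsOptimal c β F) (H : Frictions μ c β) (hn : 0 < n)
    {i : Fin n} (hi : ∀ j, j ≠ i → resPrice c β (F j) < resPrice c β (F i)) :
    (F i).law.real {t : I | ∀ j, j ≠ i → resPrice c β (F j) < t} ≤ π.selectProb F i := by
  set s : Set I := {t : I | ∀ j, j ≠ i → resPrice c β (F j) < t} with hs
  have hsm : MeasurableSet s := by
    have : s = ⋂ j : Fin n, {t : I | j ≠ i → resPrice c β (F j) < t} := by ext t; simp [hs]
    rw [this]
    refine MeasurableSet.iInter fun j => ?_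
    by_cases hj : j = i
    · simp [hj]
    · simp only [ne_eq, hj, not_false_eq_true, true_implies]
      exact measurableSet_lt measurable_const (by fun_prop)
  have hmp := measurePreserving_eval (fun i => (F i).law) i
  have e : (F i).law.real s =
      ∫ x, (Function.eval i ⁻¹' s).indicator (fun _ => (1 : ℝ)) x
        ∂Measure.pi fun i => (F i).law := by
    rw [integral_indicator_const _ (hmp.measurable hsm), smul_eq_mul, mul_one, Measure.real,
      Measure.real, hmp.measure_preimage hsm.nullMeasurableSet]
  rw [e]
  refine integral_mono_ae ((integrable_const _).indicator (hmp.measurable hsm))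
    ((π.bddMeas_selectValue i _ _).integrable _) ?_
  filter_upwards [hπ.ae_tight H hn] with x hx
  by_cases hxs : x i ∈ s
  · have h1 := π.sum_selectValue_eq_one x (n + 1) List.nodup_nil (by simp)
      (hπ.quit_eq_zero H hn _)
    rw [Finset.sum_eq_single i (fun j _ hj => hx.selectValue_eq_zero H (i := i) <|
      (capped_le j).trans_lt (lt_min (hxs j hj) (hi j hj))) (by simp)] at h1
    rw [h1]
    exact Set.indicator_le_self' (fun _ _ => zero_le_one) x
  · rw [Set.indicator_of_notMem (by exact hxs)]
    exact π.selectValue_nonneg _ _ _ _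

section FullyRevealing

variable (h0 : 0 < μ) (h1 : μ ≤ 1)

local notation "G₀" => PureStrategy.fullyRevealing μ h0.le h1

theorem fullyRevealing_one : (G₀).law {1} = ENNReal.ofReal μ := by
  simp [PureStrategy.law_fullyRevealing]

theorem fullyRevealing_compl_one : (G₀).law {1}ᶜ = ENNReal.ofReal (1 - μ) := by
  simp [PureStrategy.law_fullyRevealing]

theorem fullyRevealing_ae : ∀ᵐ t ∂(G₀).law, t = 0 ∨ t = 1 := by
  rw [ae_iff, PureStrategy.law_fullyRevealing]
  simp

/-- Probability that no box of `S` contains a prize, when these boxes reveal fully. -/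
theorem measure_forall_ne_one (S : Finset (Fin n)) (hS : ∀ j ∈ S, F j = G₀) :
    (Measure.pi fun i => (F i).law).real {x | ∀ j ∈ S, x j ≠ 1} = (1 - μ) ^ S.card := by
  have : {x : Fin n → I | ∀ j ∈ S, x j ≠ 1} =
      Set.univ.pi fun j => if j ∈ S then {1}ᶜ else Set.univ := by
    ext x
    simp only [Set.mem_ofPred_eq, Set.mem_pi, Set.mem_univ, true_implies]
    refine forall_congr' fun j => ?_
    by_cases hj : j ∈ S <;> simp [hj]
  rw [this, Measure.real, Measure.pi_pi, ← Finset.prod_subset (Finset.subset_univ S)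
    (fun j _ hj => by simp [hj]), Finset.prod_congr rfl (g := fun _ => ENNReal.ofReal (1 - μ))
    (fun j hj => by rw [if_pos hj, hS j hj, fullyRevealing_compl_one h0 h1]), Finset.prod_const,
    ENNReal.toReal_pow, ENNReal.toReal_ofReal (by linarith)]

theorem measurableSet_forall_ne_one (S : Finset (Fin n)) :
    MeasurableSet {x : Fin n → I | ∀ j ∈ S, x j ≠ 1} := by
  have : {x : Fin n → I | ∀ j ∈ S, x j ≠ 1} = ⋂ j ∈ S, Function.eval j ⁻¹' {1}ᶜ := by
    ext x; simp
  rw [this]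
  exact Finset.measurableSet_biInter _ fun j _ =>
    (measurable_pi_apply j) (measurableSet_singleton 1).compl

/-- Against fully revealing boxes, any other strategy is selected only if they all turn out to be
empty. -/
theorem IsOptimal.selectProb_le (hπ : π.IsOptimal c β F) (H : Frictions μ c β) {i : Fin n}
    (hi : F i ≠ G₀) (hF : ∀ j, j ≠ i → F j = G₀) :
    π.selectProb F i ≤ (1 - μ) ^ (n - 1) := by
  have hn : 0 < n := i.pos
  have hm := measurableSet_forall_ne_one (Finset.univ.erase i)
  have e : (1 - μ) ^ (n - 1) = ∫ x, {x : Fin n → I | ∀ j ∈ Finset.univ.erase i, x j ≠ 1}.indicator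
      (fun _ => (1 : ℝ)) x ∂Measure.pi fun i => (F i).law := by
    rw [integral_indicator_const _ hm, smul_eq_mul, mul_one,
      measure_forall_ne_one h0 h1 _ fun j hj => hF j (Finset.ne_of_mem_erase hj),
      Finset.card_erase_of_mem (Finset.mem_univ i), Finset.card_univ, Fintype.card_fin]
  rw [e]
  refine integral_mono_ae ((π.bddMeas_selectValue i _ _).integrable _)
    ((integrable_const _).indicator hm) ?_
  filter_upwards [hπ.ae_tight H hn] with x hx
  by_cases hxs : ∀ j ∈ Finset.univ.erase i, x j ≠ 1
  · rw [Set.indicator_of_mem (by exact hxs)]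
    exact π.selectValue_le_one _ _ _ _
  · rw [Set.indicator_of_notMem (by exact hxs)]
    push Not at hxs
    obtain ⟨j, hj, hj1⟩ := hxs
    refine (hx.selectValue_eq_zero H (i := j) ((capped_le i).trans_lt ?_)).le
    have hz := H.resPrice_lt h0 h1 hi
    rw [← hF j (Finset.ne_of_mem_erase hj)] at hz
    refine lt_min ?_ hz
    rw [hj1]
    exact H.resPrice_lt_one _

end FullyRevealing

end Policy

end PandoraGame

namespace PandoraGame

variable {n : ℕ} {μ c β : ℝ}

/-! ### Fair policies and fully revealing boxes -/

namespace Policy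

variable {π : Policy n} {F : Fin n → PureStrategy μ}

/-- The policy attains the pathwise bound at `x`, also after a prize is put into a box of `S`, and
after moreover the reward of some other box is raised above its reservation price. -/
structure RobustlyTight (π : Policy n) (c β : ℝ) (F : Fin n → PureStrategy μ) (S : Finset (Fin n))
    (x : Fin n → I) : Prop where
  tight : π.Tight c β F x
  tight_update : ∀ i ∈ S, π.Tight c β F (Function.update x i 1)
  exists_tight_update : ∀ k, ∀ i ∈ S, ∃ t : I, resPrice c β (F k) < t ∧
    π.Tight c β F (Function.update (Function.update x k t) i 1)

section

variable (h0 : 0 < μ) (h1 : μ ≤ 1)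

local notation "G₀" => PureStrategy.fullyRevealing μ h0.le h1

theorem IsOptimal.ae_robustlyTight (hπ : π.IsOptimal c β F) (H : Frictions μ c β) (hn : 0 < n)
    {S : Finset (Fin n)} (hS : ∀ i ∈ S, F i = G₀) :
    ∀ᵐ x ∂Measure.pi fun i => (F i).law, π.RobustlyTight c β F S x := by
  have ht := hπ.ae_tight H hn
  have h1' : ∀ i ∈ S, ∀ᵐ x ∂Measure.pi fun i => (F i).law,
      π.Tight c β F (Function.update x i 1) := fun i hi => by
    filter_upwards [ae_ae_update ht i] with x hx
    have : (F i).law {1} ≠ 0 := by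
      rw [hS i hi, fullyRevealing_one h0 h1]
      simpa using h0
    obtain ⟨t, rfl, h⟩ := exists_mem_of_ae hx this
    exact h
  have h2' : ∀ k, ∀ i ∈ S, ∀ᵐ x ∂Measure.pi fun i => (F i).law,
      ∃ t : I, resPrice c β (F k) < t ∧
        π.Tight c β F (Function.update (Function.update x k t) i 1) := fun k i hi => by
    filter_upwards [ae_ae_update (h1' i hi) k] with x hx
    exact exists_mem_of_ae hx (H.measure_gt_resPrice_pos (F k)).ne'
  have h1'' := (Finset.eventually_all S).2 h1'
  have h2'' := Filter.eventually_all.2 fun k => (Finset.eventually_all S).2 (h2' k)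
  filter_upwards [ht, h1'', h2''] with x a b d
  exact ⟨a, b, d⟩

theorem length_le_of_nodup {l : List (Fin n)} (hl : l.Nodup) : l.length ≤ n := by
  simpa using hl.length_le_card

variable {h0 h1} {S : Finset (Fin n)} {x : Fin n → I} {l : List (Fin n)}

/-- No empty box is taken while there is an uninspected box of `S`, since it may hold a prize. -/
theorem RobustlyTight.take_eq_zero (hx : π.RobustlyTight c β F S x) (H : Frictions μ c β)
    (hl : 0 < π.reach l x) {i j : Fin n} (hi : i ∈ S) (hil : i ∉ l) (hj : x j = 0) :
    π.prob l x (.take j) = 0 := by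
  by_contra hne
  have hagree : ∀ k ∈ l, Function.update x i 1 k = x k := fun k hk =>
    Function.update_of_ne (fun (e : k = i) => hil (e ▸ hk)) _ _
  have hlen := length_le_of_nodup (nodup_of_reach_pos hl)
  have hp : 0 < π.prob l (Function.update x i 1) (.take j) := by
    rw [π.adapted l _ _ _ hagree]
    exact lt_of_le_of_ne (π.prob_nonneg _ _ _) (Ne.symm hne)
  have hji : j ≠ i := fun e => hil (e ▸ mem_of_take_pos hp)
  rw [← reach_congr hagree] at hl
  have ht := π.tight_of_reach_pos H.discount_pos H.discount_le_one (hx.tight_update i hi) hl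
    (k := n - l.length + 1) (by omega)
  have := (π.tight_take H.discount_pos H.discount_le_one ht hp).1 i
  have e1 : capped (fun i => resPrice c β (F i)) (Function.update x i 1) j ≤ 0 := by
    refine (capped_le_coe j).trans ?_
    rw [Function.update_of_ne hji, hj]
    exact le_rfl
  have e2 : 0 < capped (fun i => resPrice c β (F i)) (Function.update x i 1) i := by
    refine lt_min ?_ (H.resPrice_pos _)
    rw [Function.update_self]
    exact one_pos
  linarith

/-- No other box is inspected while there is an uninspected box of `S`: it might have a reward above
its reservation price, and the box of `S` might still be better. -/
theorem RobustlyTight.inspect_eq_zero (hx : π.RobustlyTight c β F S x) (H : Frictions μ c β)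
    (hq : π.prob [] x .quit = 0) (hl : 0 < π.reach l x) {i k : Fin n} (hi : i ∈ S) (hil : i ∉ l)
    (hk : resPrice c β (F k) < resPrice c β (F i)) : π.prob l x (.inspect k) = 0 := by
  by_contra hne
  obtain ⟨t, ht, htight⟩ := hx.exists_tight_update k i hi
  have hp := lt_of_le_of_ne (π.prob_nonneg _ _ _) (Ne.symm hne)
  have hkl := notMem_of_inspect_pos hp
  have hki : k ≠ i := by rintro rfl; exact lt_irrefl _ hk
  set y := Function.update (Function.update x k t) i 1 with hy
  have hagree : ∀ j ∈ l, y j = x j := fun j hj => by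
    rw [hy, Function.update_of_ne (fun (e : j = i) => hil (e ▸ hj)),
      Function.update_of_ne (fun (e : j = k) => hkl (e ▸ hj))]
  have hreach : 0 < π.reach (k :: l) y := by
    rw [reach_cons_pos, reach_congr hagree, π.adapted l _ _ _ hagree]
    exact ⟨hl, hp⟩
  have hnd := nodup_of_reach_pos hreach
  have hlen := length_le_of_nodup hnd
  have hT := π.tight_of_reach_pos H.discount_pos H.discount_le_one htight hreach
    (k := n + 1 - (k :: l).length) (by omega)
  have hsum := π.sum_selectValue_eq_one y (n + 1 - (k :: l).length) hnd (by omega)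
    (by rw [π.adapted [] y x .quit (by simp), hq])
  obtain ⟨j, -, hj⟩ := Finset.exists_ne_zero_of_sum_ne_zero (hsum.trans_ne one_ne_zero)
  obtain ⟨a, b⟩ := π.tight_select H.discount_pos H.discount_le_one hT
    (lt_of_le_of_ne (π.selectValue_nonneg _ _ _ _) (Ne.symm hj))
  have hkj : k = j := b k (by simp) (excess_pos (by
    rw [hy, Function.update_of_ne hki, Function.update_self]; exact ht))
  have e1 := a i
  have e2 : capped (fun i => resPrice c β (F i)) y i = resPrice c β (F i) := by
    refine min_eq_right ?_
    rw [hy, Function.update_self]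
    exact (H.resPrice_lt_one (F i)).le
  have e3 := capped_le (z := fun i => resPrice c β (F i)) (x := y) j
  rw [← hkj] at e1 e3
  linarith

/-- The data of the fairness argument: `S` is the set of fully revealing boxes, and `x` is a profile
of rewards at which the policy is robustly tight. -/
structure FairContext (π : Policy n) (c β : ℝ) (F : Fin n → PureStrategy μ) (S : Finset (Fin n))
    (x : Fin n → I) : Prop where
  frictions : Frictions μ c β
  fair : π.IsFair c β F
  robust : π.RobustlyTight c β F S x
  quit : π.prob [] x .quit = 0
  price_eq : ∀ i ∈ S, ∀ j ∈ S, resPrice c β (F i) = resPrice c β (F j)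
  price_lt : ∀ i ∈ S, ∀ k, k ∉ S → resPrice c β (F k) < resPrice c β (F i)
  reward : ∀ j ∈ S, x j = 0 ∨ x j = 1

/-- As long as no prize was found, the boxes of `S` are inspected in uniformly random order. -/
theorem FairContext.prob_inspect (h : π.FairContext c β F S x) (hl : 0 < π.reach l x)
    (hl0 : ∀ j ∈ l, x j = 0) {i : Fin n} (hi : i ∈ S) (hil : i ∉ l) :
    (∀ j, j ∈ S → j ∉ l → π.prob l x (.inspect j) = 1 / (S.filter (· ∉ l)).card) ∧
      (∀ j, j ∉ S.filter (· ∉ l) → π.prob l x (.inspect j) = 0) ∧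
      ∀ j, π.prob l x (.take j) = 0 := by
  have hz1 : ∀ j, j ∉ S.filter (· ∉ l) → π.prob l x (.inspect j) = 0 := fun j hj => by
    by_cases hjl : j ∈ l
    · exact π.inspect_legal l x j hjl
    · have hjS : j ∉ S := fun hjS => hj (Finset.mem_filter.2 ⟨hjS, hjl⟩)
      exact h.robust.inspect_eq_zero h.frictions h.quit hl hi hil (h.price_lt i hi j hjS)
  have hz2 : ∀ j, π.prob l x (.take j) = 0 := fun j => by
    by_cases hjl : j ∈ l
    · exact h.robust.take_eq_zero h.frictions hl hi hil (hl0 j hjl)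
    · exact π.take_legal l x j hjl
  have hz3 : π.prob l x .quit = 0 := by
    by_cases hnil : l = []
    · rw [hnil, h.quit]
    · exact π.quit_legal l x hnil
  refine ⟨fun j hj hjl => ?_, hz1, hz2⟩
  have hmax : ∀ j ∈ S, ∀ k, k ∉ l → resPrice c β (F k) ≤ resPrice c β (F j) := fun j hj k _ => by
    by_cases hk : k ∈ S
    · exact (h.price_eq k hk j hj).le
    · exact (h.price_lt j hj k hk).le
  have hsum := π.prob_sum l x
  rw [hz3, Finset.sum_eq_zero (fun j _ => hz2 j), add_zero, add_zero,
    ← Finset.sum_subset (Finset.subset_univ (S.filter (· ∉ l))) (fun j _ hj => hz1 j hj),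
    Finset.sum_congr rfl (g := fun _ => π.prob l x (.inspect j)) (fun k hk => by
      rw [Finset.mem_filter] at hk
      exact (h.fair _ (fun i => h.frictions.isReservationPrice (F i)) l x).1 k j hk.2 hjl
        (hmax k hk.1) (hmax j hj)), Finset.sum_const, nsmul_eq_mul] at hsum
  exact eq_one_div_of_mul_eq_one_right hsum

/-- A prize is taken when it is found. -/
theorem FairContext.selectValue_cons (h : π.FairContext c β F S x) {j : Fin n}
    (hl : 0 < π.reach (j :: l) x) (hj : x j = 1) {k : ℕ} (hk : k + (j :: l).length = n + 1)
    (i : Fin n) : π.selectValue i k (j :: l) x = if j = i then 1 else 0 := by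
  have hT := π.tight_of_reach_pos h.frictions.discount_pos h.frictions.discount_le_one
    h.robust.tight hl hk
  have hz : ∀ i, i ≠ j → π.selectValue i k (j :: l) x = 0 := fun i hij => by
    by_contra hne
    refine hij ((π.tight_select h.frictions.discount_pos h.frictions.discount_le_one hT
      (lt_of_le_of_ne (π.selectValue_nonneg _ _ _ _) (Ne.symm hne))).2 j (by simp)
      (excess_pos ?_)).symm
    rw [hj]
    exact h.frictions.resPrice_lt_one _
  split_ifs with hji
  · subst hji
    have hsum := π.sum_selectValue_eq_one x k (nodup_of_reach_pos hl) hk.ge h.quit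
    rwa [Finset.sum_eq_single j (fun i _ hij => hz i hij) (by simp)] at hsum
  · exact hz i (Ne.symm hji)

/-- The boxes of `S` with a prize are selected with equal probabilities. -/
theorem FairContext.selectValue_eq (h : π.FairContext c β F S x) {i : Fin n} (hi : i ∈ S)
    (hi1 : x i = 1) {k : ℕ} (hl : 0 < π.reach l x) (hl0 : ∀ j ∈ l, x j = 0)
    (hk : k + l.length = n + 1) :
    π.selectValue i k l x = 1 / (S.filter (x · = 1)).card := by
  induction k generalizing l with
  | zero => have := length_le_of_nodup (nodup_of_reach_pos hl); omega
  | succ k ih =>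
    have hnl : ∀ j, x j = 1 → j ∉ l := fun j hj hjl => by
      rw [hl0 j hjl] at hj; exact zero_ne_one hj
    obtain ⟨p1, p2, p3⟩ := h.prob_inspect hl hl0 hi (hnl i hi1)
    set R := S.filter (· ∉ l) with hR
    set A := S.filter (x · = 1) with hA
    have hiR : i ∈ R := Finset.mem_filter.2 ⟨hi, hnl i hi1⟩
    have hiA : i ∈ A := Finset.mem_filter.2 ⟨hi, hi1⟩
    have hAR : A ⊆ R := fun j hj => by
      rw [hA, Finset.mem_filter] at hj
      exact Finset.mem_filter.2 ⟨hj.1, hnl j hj.2⟩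
    have hr : (0 : ℝ) < R.card := by exact_mod_cast Finset.card_pos.2 ⟨i, hiR⟩
    have ha : (0 : ℝ) < A.card := by exact_mod_cast Finset.card_pos.2 ⟨i, hiA⟩
    have hreach : ∀ j ∈ R, 0 < π.reach (j :: l) x := fun j hj => by
      rw [hR, Finset.mem_filter] at hj
      rw [reach_cons_pos, p1 j hj.1 hj.2]
      exact ⟨hl, one_div_pos.2 hr⟩
    have hlen : ∀ j : Fin n, k + (j :: l).length = n + 1 := fun j => by
      rw [List.length_cons]; omega
    have v1 : ∀ j ∈ A, π.prob l x (.inspect j) * π.selectValue i k (j :: l) x =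
        (1 / R.card) * if j = i then 1 else 0 := fun j hj => by
      have hjR := hAR hj
      rw [h.selectValue_cons (hreach j hjR) (Finset.mem_filter.1 hj).2 (hlen j),
        p1 j (Finset.mem_filter.1 hjR).1 (Finset.mem_filter.1 hjR).2]
    have v2 : ∀ j ∈ R \ A, π.prob l x (.inspect j) * π.selectValue i k (j :: l) x =
        (1 / R.card) * (1 / A.card) := fun j hj => by
      rw [Finset.mem_sdiff] at hj
      have hjR := Finset.mem_filter.1 hj.1
      have hj0 : x j = 0 := (h.reward j hjR.1).resolve_right fun e =>
        hj.2 (Finset.mem_filter.2 ⟨hjR.1, e⟩)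
      rw [ih (hreach j hj.1) (fun m hm => ?_) (hlen j), p1 j hjR.1 hjR.2]
      rcases List.mem_cons.1 hm with rfl | hm
      · exact hj0
      · exact hl0 m hm
    rw [selectValue, p3 i, add_zero, ← Finset.sum_subset (Finset.subset_univ R)
      (fun j _ hj => by rw [p2 j hj, zero_mul]), ← Finset.sum_sdiff hAR,
      Finset.sum_congr rfl v1, Finset.sum_congr rfl v2, Finset.sum_const, ← Finset.mul_sum,
      Finset.sum_ite_eq' A i, if_pos hiA, nsmul_eq_mul, Finset.card_sdiff_of_subset hAR,
      Nat.cast_sub (Finset.card_le_card hAR)]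
    field_simp
    ring

/-- If all boxes are fully revealing and turn out to be empty, they are selected with equal
probabilities. -/
theorem FairContext.selectValue_eq_of_zero (h : π.FairContext c β F Finset.univ x)
    (hx0 : ∀ j, x j = 0) (i : Fin n) {k : ℕ} (hl : 0 < π.reach l x) (hk : k + l.length = n + 1) :
    π.selectValue i k l x = 1 / n := by
  induction k generalizing l with
  | zero => have := length_le_of_nodup (nodup_of_reach_pos hl); omega
  | succ k ih =>
    by_cases hfull : ∀ j, j ∈ l
    · have hz : ∀ j, π.prob l x (.inspect j) = 0 := fun j => π.inspect_legal l x j (hfull j)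
      have hsum := π.prob_sum l x
      have hmax : ∀ j, ∀ k ∈ l, x k ≤ x j := fun j k _ => by rw [hx0, hx0]
      rw [π.quit_legal l x (List.ne_nil_of_mem (hfull i)), Finset.sum_eq_zero (fun j _ => hz j),
        zero_add, add_zero, Finset.sum_congr rfl (g := fun _ => π.prob l x (.take i)) (fun k _ =>
          (h.fair _ (fun i => h.frictions.isReservationPrice (F i)) l x).2 k i (hfull k) (hfull i)
          (hmax k) (hmax i)), Finset.sum_const, Finset.card_univ, Fintype.card_fin,
        nsmul_eq_mul] at hsum
      rw [selectValue, Finset.sum_eq_zero (fun j _ => by rw [hz j, zero_mul]), zero_add]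
      exact eq_one_div_of_mul_eq_one_right hsum
    · push Not at hfull
      obtain ⟨m, hm⟩ := hfull
      obtain ⟨p1, p2, p3⟩ := h.prob_inspect hl (fun j _ => hx0 j) (Finset.mem_univ m) hm
      set R := Finset.univ.filter (· ∉ l) with hR
      have hr : (0 : ℝ) < R.card := by
        exact_mod_cast Finset.card_pos.2 ⟨m, Finset.mem_filter.2 ⟨Finset.mem_univ m, hm⟩⟩
      have v : ∀ j ∈ R, π.prob l x (.inspect j) * π.selectValue i k (j :: l) x =
          (1 / R.card) * (1 / n) := fun j hj => by
        have hjl := (Finset.mem_filter.1 hj).2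
        rw [ih _ (by rw [List.length_cons]; omega), p1 j (Finset.mem_univ j) hjl]
        rw [reach_cons_pos, p1 j (Finset.mem_univ j) hjl]
        exact ⟨hl, one_div_pos.2 hr⟩
      rw [selectValue, p3 i, add_zero, ← Finset.sum_subset (Finset.subset_univ R)
        (fun j _ hj => by rw [p2 j hj, zero_mul]), Finset.sum_congr rfl v, Finset.sum_const,
        nsmul_eq_mul]
      field_simp

variable (S) in
open Classical in
/-- The share of box `i` in a prize that is split evenly among the boxes of `S` that contain one; if
there is none, every box gets `δ`. -/
noncomputable def share (δ : ℝ) (x : Fin n → I) (i : Fin n) : ℝ :=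
  if ∀ j ∈ S, x j ≠ 1 then δ else if x i = 1 then 1 / (S.filter (x · = 1)).card else 0

theorem sum_share (δ : ℝ) : ∑ i ∈ S, share S δ x i =
    1 + (S.card * δ - 1) * {x : Fin n → I | ∀ j ∈ S, x j ≠ 1}.indicator (fun _ => 1) x := by
  classical
  by_cases hx : ∀ j ∈ S, x j ≠ 1
  · rw [Set.indicator_of_mem (by exact hx)]
    simp only [share, if_pos hx, Finset.sum_const, nsmul_eq_mul]
    ring
  · rw [Set.indicator_of_notMem (by exact hx)]
    simp only [share, if_neg hx]
    rw [← Finset.sum_filter, Finset.sum_const, nsmul_eq_mul, mul_zero, add_zero]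
    push Not at hx
    obtain ⟨j, hj, hj1⟩ := hx
    have : (0 : ℝ) < (S.filter (x · = 1)).card := by
      exact_mod_cast Finset.card_pos.2 ⟨j, Finset.mem_filter.2 ⟨hj, hj1⟩⟩
    field_simp

theorem bddMeas_share (δ : ℝ) (i : Fin n) : BddMeas fun x => share S δ x i := by
  classical
  have hone : ∀ j, MeasurableSet {x : Fin n → I | x j = 1} := fun j =>
    (measurable_pi_apply j) (measurableSet_singleton 1)
  refine .of_mem_Icc (a := min δ 0) (b := max δ 1) ?_ fun x => ?_
  · unfold share
    refine Measurable.ite (measurableSet_forall_ne_one S) measurable_const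
      (Measurable.ite (hone i) ?_ measurable_const)
    simp only [Finset.card_filter, Nat.cast_sum]
    refine measurable_const.div (Finset.measurable_sum _ fun j _ => ?_)
    simp only [Nat.cast_ite]
    exact Measurable.ite (hone j) measurable_const measurable_const
  · unfold share
    split_ifs
    · exact ⟨min_le_left _ _, le_max_left _ _⟩
    · refine ⟨(min_le_right _ _).trans (by positivity), le_max_of_le_right ?_⟩
      rw [one_div]
      exact Nat.cast_inv_le_one _
    · exact ⟨min_le_right _ _, le_max_of_le_right zero_le_one⟩

/-- Boxes with the same distribution can be exchanged. -/
theorem measurePreserving_swap {i j : Fin n} (hij : F i = F j) :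
    MeasurePreserving (fun x : Fin n → I => x ∘ Equiv.swap i j)
      (Measure.pi fun i => (F i).law) (Measure.pi fun i => (F i).law) := by
  have hm : Measurable fun x : Fin n → I => x ∘ Equiv.swap i j :=
    measurable_pi_lambda _ fun k => measurable_pi_apply _
  have hF : ∀ k, F (Equiv.swap i j k) = F k := fun k => by
    rcases eq_or_ne k i with rfl | hki
    · rw [Equiv.swap_apply_left, hij]
    · rcases eq_or_ne k j with rfl | hkj
      · rw [Equiv.swap_apply_right, hij]
      · rw [Equiv.swap_apply_of_ne_of_ne hki hkj]
  refine ⟨hm, (Measure.pi_eq fun s hs => ?_).symm⟩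
  rw [Measure.map_apply hm (MeasurableSet.univ_pi hs)]
  have : (fun x : Fin n → I => x ∘ Equiv.swap i j) ⁻¹' Set.univ.pi s =
      Set.univ.pi fun k => s (Equiv.swap i j k) := by
    ext x
    simp only [Set.mem_preimage, Set.mem_pi, Set.mem_univ, true_implies, Function.comp]
    constructor
    · intro h k; simpa using h (Equiv.swap i j k)
    · intro h k; simpa using h (Equiv.swap i j k)
  rw [this, Measure.pi_pi, ← Equiv.prod_comp (Equiv.swap i j) fun k => (F k).law (s k)]
  simp only [hF]

theorem share_swap (δ : ℝ) {i j : Fin n} (hi : i ∈ S) (hj : j ∈ S) :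
    share S δ (x ∘ Equiv.swap i j) i = share S δ x j := by
  have hmem : ∀ k, Equiv.swap i j k ∈ S ↔ k ∈ S := fun k => by
    rcases eq_or_ne k i with rfl | hki
    · rw [Equiv.swap_apply_left]; exact iff_of_true hj hi
    · rcases eq_or_ne k j with rfl | hkj
      · rw [Equiv.swap_apply_right]; exact iff_of_true hi hj
      · rw [Equiv.swap_apply_of_ne_of_ne hki hkj]
  have e1 : (∀ k ∈ S, (x ∘ Equiv.swap i j) k ≠ 1) ↔ ∀ k ∈ S, x k ≠ 1 := by
    constructor
    · intro h k hk
      have := h (Equiv.swap i j k) ((hmem k).2 hk)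
      simpa using this
    · intro h k hk
      exact h _ ((hmem k).2 hk)
  have e2 : (S.filter ((x ∘ Equiv.swap i j) · = 1)).card = (S.filter (x · = 1)).card := by
    refine Finset.card_bij (fun k _ => Equiv.swap i j k) (fun k hk => ?_)
      (fun _ _ _ _ h => (Equiv.swap i j).injective h) (fun k hk => ?_)
    · rw [Finset.mem_filter] at hk ⊢
      exact ⟨(hmem k).2 hk.1, hk.2⟩
    · rw [Finset.mem_filter] at hk
      refine ⟨Equiv.swap i j k, Finset.mem_filter.2 ⟨(hmem k).2 hk.1, ?_⟩, by simp⟩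
      simpa using hk.2
  simp only [Function.comp] at e1 e2
  simp only [share, Function.comp, e1, e2, Equiv.swap_apply_left]

theorem integral_share (δ : ℝ) (hS : ∀ j ∈ S, F j = G₀) {i : Fin n} (hi : i ∈ S) :
    S.card * ∫ x, share S δ x i ∂(Measure.pi fun i => (F i).law) =
      1 + (S.card * δ - 1) * (1 - μ) ^ S.card := by
  have hsymm : ∀ j ∈ S, ∫ x, share S δ x j ∂(Measure.pi fun i => (F i).law) =
      ∫ x, share S δ x i ∂(Measure.pi fun i => (F i).law) := fun j hj => by
    have hmp := measurePreserving_swap (F := F) (i := i) (j := j) (by rw [hS i hi, hS j hj])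
    conv_rhs => rw [← hmp.map_eq, integral_map hmp.measurable.aemeasurable
      (bddMeas_share δ i).measurable.aestronglyMeasurable]
    simp only [share_swap δ hi hj]
  have hm := measurableSet_forall_ne_one S
  rw [← nsmul_eq_mul, ← Finset.sum_const, ← Finset.sum_congr rfl hsymm,
    ← integral_finsetSum _ fun j _ => (bddMeas_share δ j).integrable _]
  simp only [sum_share]
  rw [integral_add (integrable_const _) (((integrable_const _).indicator hm).const_mul _),
    integral_const_mul, integral_indicator_const _ hm, measure_forall_ne_one h0 h1 S hS]
  simp

theorem IsOptimal.ae_fairContext (hπ : π.IsOptimal c β F) (hfair : π.IsFair c β F)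
    (H : Frictions μ c β) (hn : 0 < n) (hS : ∀ j, j ∈ S ↔ F j = G₀) :
    ∀ᵐ x ∂Measure.pi fun i => (F i).law, π.FairContext c β F S x := by
  have hrew : ∀ᵐ x ∂Measure.pi fun i => (F i).law, ∀ j ∈ S, x j = 0 ∨ x j = 1 := by
    refine (Finset.eventually_all S).2 fun j hj => ?_
    have := fullyRevealing_ae h0 h1
    rw [← (hS j).1 hj] at this
    exact (measurePreserving_eval (fun i => (F i).law) j).quasiMeasurePreserving.ae this
  filter_upwards [hrew, hπ.ae_robustlyTight h0 h1 H hn fun i hi => (hS i).1 hi] with x hx hr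
  refine ⟨H, hfair, hr, hπ.quit_eq_zero H hn x, fun i hi j hj => ?_, fun i hi k hk => ?_, hx⟩
  · rw [(hS i).1 hi, (hS j).1 hj]
  · rw [(hS i).1 hi]
    exact H.resPrice_lt h0 h1 fun e => hk ((hS k).2 e)

/-- A fully revealing box is selected at least with the probability that it wins a fair lottery
among the fully revealing boxes that contain a prize. -/
theorem IsOptimal.share_le_selectProb (hπ : π.IsOptimal c β F) (hfair : π.IsFair c β F)
    (H : Frictions μ c β) (hS : ∀ j, j ∈ S ↔ F j = G₀) {i : Fin n} (hi : i ∈ S) {δ : ℝ}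
    (hδ : δ = 0 ∨ S = Finset.univ ∧ δ = 1 / n) :
    (1 + (S.card * δ - 1) * (1 - μ) ^ S.card) / S.card ≤ π.selectProb F i := by
  have hn : 0 < n := i.pos
  have hcard : (0 : ℝ) < S.card := by exact_mod_cast Finset.card_pos.2 ⟨i, hi⟩
  rw [← integral_share (h0 := h0) (h1 := h1) δ (fun j hj => (hS j).1 hj) hi,
    mul_div_cancel_left₀ _ hcard.ne']
  refine integral_mono_ae ((bddMeas_share δ i).integrable _)
    ((π.bddMeas_selectValue i _ _).integrable _) ?_
  filter_upwards [hπ.ae_fairContext (h0 := h0) (h1 := h1) hfair H hn hS] with x hx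
  unfold share
  split_ifs with hA hi1
  · rcases hδ with rfl | ⟨rfl, rfl⟩
    · exact π.selectValue_nonneg _ _ _ _
    · exact (hx.selectValue_eq_of_zero (fun j => (hx.reward j (Finset.mem_univ j)).resolve_right
        (hA j (Finset.mem_univ j))) i (l := []) one_pos (by simp)).ge
  · convert (hx.selectValue_eq hi hi1 (l := []) (k := n + 1) one_pos (by simp) (by simp)).ge
  · exact π.selectValue_nonneg _ _ _ _

end

end Policy

end PandoraGame

namespace PandoraGame

variable {n : ℕ} {μ c β : ℝ}

/-! ### Numerical inequalities -/

/-- The function `m ↦ (1 - q ^ m) / m` is decreasing. -/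
theorem mul_one_sub_pow_le {q : ℝ} (hq0 : 0 ≤ q) (hq1 : q ≤ 1) {m N : ℕ} (h : m ≤ N) :
    m * (1 - q ^ N) ≤ N * (1 - q ^ m) := by
  have hgeom : ∀ j ≤ m, j * ((1 - q) * q ^ m) ≤ 1 - q ^ j := fun j hj => by
    induction j with
    | zero => simp
    | succ j ih =>
      have h1 := ih (by omega)
      have h2 : q ^ m ≤ q ^ j := pow_le_pow_of_le_one hq0 hq1 (by omega)
      push_cast
      rw [pow_succ]
      nlinarith [mul_le_mul_of_nonneg_left h2 (sub_nonneg.2 hq1)]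
  induction N, h using Nat.le_induction with
  | base => exact le_rfl
  | succ N hN ih =>
    have h2 : q ^ N ≤ q ^ m := pow_le_pow_of_le_one hq0 hq1 hN
    have h3 := hgeom m le_rfl
    have h4 := mul_le_mul_of_nonneg_left h2 (mul_nonneg (Nat.cast_nonneg (α := ℝ) m)
      (sub_nonneg.2 hq1))
    push_cast
    rw [pow_succ]
    nlinarith

theorem inv_le_one_sub_pow_div {q : ℝ} (hq0 : 0 ≤ q) (hq1 : q ≤ 1) (hq : q ^ (n - 1) ≤ 1 / n)
    {m : ℕ} (hm0 : 0 < m) (hmn : m < n) : 1 / (n : ℝ) ≤ (1 - q ^ m) / m := by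
  obtain ⟨N, rfl⟩ : ∃ N, n = N + 1 := ⟨n - 1, by omega⟩
  rw [Nat.add_sub_cancel] at hq
  have h := mul_one_sub_pow_le hq0 hq1 (show m ≤ N by omega)
  have hN : (0 : ℝ) < N := by exact_mod_cast (show 0 < N by omega)
  have hm : (0 : ℝ) < m := by exact_mod_cast hm0
  rw [le_div_iff₀ hm]
  push_cast at hq ⊢
  have e : (1 : ℝ) - 1 / (N + 1) = N * (1 / (N + 1)) := by field_simp; ring
  have h2 : (m : ℝ) * (N * (1 / (N + 1))) ≤ N * (1 - q ^ m) :=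
    (mul_le_mul_of_nonneg_left (by linarith) hm.le).trans h
  refine le_of_mul_le_mul_left ?_ hN
  linarith

theorem inv_lt_mean (hn : 2 ≤ n) (h0 : 0 < μ) (h1 : μ ≤ 1) (hq : (1 - μ) ^ (n - 1) ≤ 1 / n)
    (hne : ¬ (n = 2 ∧ μ = 1 / 2)) : 1 / (n : ℝ) < μ := by
  rcases hn.eq_or_lt with rfl | hn
  · norm_num at hq hne ⊢
    exact lt_of_le_of_ne (by linarith) (Ne.symm hne)
  · have := inv_le_one_sub_pow_div (sub_nonneg.2 h1) (by linarith) hq two_pos hn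
    push_cast at this
    nlinarith [pow_pos h0 2]

theorem pow_le_inv_of_rpow_le (hn : 2 ≤ n) (h1 : μ ≤ 1)
    (h : 1 - (1 / (n : ℝ)) ^ (1 / ((n : ℝ) - 1)) ≤ μ) : (1 - μ) ^ (n - 1) ≤ 1 / n := by
  have hn1 : (0 : ℝ) < (n : ℝ) - 1 := by
    have : (2 : ℝ) ≤ n := by exact_mod_cast hn
    linarith
  have hinv : (0 : ℝ) ≤ 1 / n := by positivity
  calc (1 - μ) ^ (n - 1) ≤ ((1 / (n : ℝ)) ^ (1 / ((n : ℝ) - 1))) ^ (n - 1) :=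
        pow_le_pow_left₀ (by linarith) (by linarith) _
    _ = 1 / n := by
        rw [← Real.rpow_natCast, ← Real.rpow_mul hinv, Nat.cast_pred (by omega),
          one_div_mul_cancel hn1.ne', Real.rpow_one]

theorem exists_pow_le_inv (h0 : 0 < μ) (h1 : μ < 1) :
    ∃ N : ℕ, ∀ n : ℕ, N ≤ n → (1 - μ) ^ (n - 1) ≤ 1 / (n : ℝ) := by
  have ht := tendsto_self_mul_const_pow_of_lt_one (r := 1 - μ) (by linarith) (by linarith)
  obtain ⟨N, hN⟩ := Filter.eventually_atTop.1 (ht.eventually_le_const (show 0 < 1 - μ by linarith))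
  refine ⟨max N 1, fun n hn => ?_⟩
  have h := hN n ((le_max_left _ _).trans hn)
  obtain ⟨m, rfl⟩ : ∃ m, n = m + 1 := ⟨n - 1, by have := (le_max_right N 1).trans hn; omega⟩
  rw [Nat.add_sub_cancel, le_div_iff₀ (by positivity)]
  rw [pow_succ] at h
  have hpos : 0 < 1 - μ := by linarith
  refine le_of_mul_le_mul_right (a := 1 - μ) ?_ hpos
  linarith

/-! ### Mixed strategies and payoffs -/

instance : T2Space (PureStrategy μ) :=
  inferInstanceAs (T2Space {F : ProbabilityMeasure I // ∫ x, (x : ℝ) ∂(F : Measure I) = μ})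

theorem toMixed_injective : Function.Injective (PureStrategy.toMixed (μ := μ)) := fun F G h => by
  have h' : Measure.dirac F = Measure.dirac G := congrArg Subtype.val h
  by_contra hne
  exact dirac_ne_dirac hne h'

theorem eq_toMixed_of_measure_singleton {s : MixedStrategy μ} {G : PureStrategy μ}
    (h : (s : Measure (PureStrategy μ)) {G} = 1) : s = G.toMixed := by
  apply Subtype.ext
  have hae : ∀ᵐ F ∂(s : Measure (PureStrategy μ)), F = G := by
    rw [← prob_compl_eq_zero_iff (measurableSet_singleton G)] at h
    exact h
  ext t ht
  change (s : Measure (PureStrategy μ)) t = Measure.dirac G t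
  rw [Measure.dirac_apply' _ ht]
  by_cases hG : G ∈ t
  · rw [Set.indicator_of_mem hG, Pi.one_apply, ← prob_compl_eq_zero_iff ht]
    refine measure_mono_null (fun F hF (e : F = G) => hF (e ▸ hG)) hae
  · rw [Set.indicator_of_notMem hG]
    refine measure_mono_null (fun F hF (e : F = G) => hG (e ▸ hF)) hae

theorem ae_eq_of_toMixed {s : Fin n → MixedStrategy μ} {j : Fin n} {G : PureStrategy μ}
    (h : s j = G.toMixed) :
    ∀ᵐ F ∂Measure.pi fun j => (s j : Measure (PureStrategy μ)), F j = G := by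
  have : ∀ᵐ K ∂(s j : Measure (PureStrategy μ)), K = G := by
    rw [h]
    change ∀ᵐ K ∂Measure.dirac G, K = G
    exact (ae_dirac_iff (measurableSet_singleton G)).2 rfl
  exact (measurePreserving_eval (fun j => (s j : Measure (PureStrategy μ)))
    j).quasiMeasurePreserving.ae this

theorem le_expectedPayoff {η : (Fin n → PureStrategy μ) → Policy n} {s : Fin n → MixedStrategy μ}
    {i : Fin n} {a : ℝ} (h : ∀ᵐ F ∂Measure.pi fun j => (s j : Measure (PureStrategy μ)),
      a ≤ (η F).selectProb F i) : ENNReal.ofReal a ≤ expectedPayoff η s i := by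
  unfold expectedPayoff
  calc ENNReal.ofReal a = ∫⁻ _, ENNReal.ofReal a
        ∂Measure.pi fun j => (s j : Measure (PureStrategy μ)) := by simp
    _ ≤ _ := lintegral_mono_ae (h.mono fun F hF => ENNReal.ofReal_le_ofReal hF)

theorem expectedPayoff_le {η : (Fin n → PureStrategy μ) → Policy n} {s : Fin n → MixedStrategy μ}
    {i : Fin n} {a : ℝ} (h : ∀ᵐ F ∂Measure.pi fun j => (s j : Measure (PureStrategy μ)),
      (η F).selectProb F i ≤ a) : expectedPayoff η s i ≤ ENNReal.ofReal a := by
  unfold expectedPayoff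
  calc _ ≤ ∫⁻ _, ENNReal.ofReal a
        ∂Measure.pi fun j => (s j : Measure (PureStrategy μ)) :=
      lintegral_mono_ae (h.mono fun F hF => ENNReal.ofReal_le_ofReal hF)
    _ = ENNReal.ofReal a := by simp

theorem Policy.selectProb_nonneg (π : Policy n) (F : Fin n → PureStrategy μ) (i : Fin n) :
    0 ≤ π.selectProb F i := integral_nonneg fun x => π.selectValue_nonneg x i _ _

theorem Policy.sum_selectProb_le_one (π : Policy n) (F : Fin n → PureStrategy μ) :
    ∑ i, π.selectProb F i ≤ 1 := by
  unfold selectProb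
  rw [← integral_finsetSum _ fun i _ => (π.bddMeas_selectValue i _ _).integrable _]
  calc _ ≤ ∫ _, (1 : ℝ) ∂Measure.pi fun i => (F i).law :=
        integral_mono ((BddMeas.sum fun i _ => π.bddMeas_selectValue i _ _).integrable _)
          (integrable_const _) fun x => π.sum_selectValue_le_one x _ _
    _ = 1 := by simp

theorem sum_lintegral_le {X ι : Type*} [MeasurableSpace X] (m : Measure X) (s : Finset ι)
    (f : ι → X → ℝ≥0∞) : ∑ i ∈ s, ∫⁻ x, f i x ∂m ≤ ∫⁻ x, ∑ i ∈ s, f i x ∂m := by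
  classical
  induction s using Finset.induction_on with
  | empty => simp
  | insert a s ha ih =>
    simp only [Finset.sum_insert ha]
    exact (add_le_add_right ih _).trans (le_lintegral_add _ _)

/-- In any profile, some box gets at most its fair share. -/
theorem exists_expectedPayoff_le (hn : 0 < n) (η : (Fin n → PureStrategy μ) → Policy n)
    (s : Fin n → MixedStrategy μ) : ∃ i, expectedPayoff η s i ≤ ENNReal.ofReal (1 / n) := by
  have : ∑ i, expectedPayoff η s i ≤ ∑ _i : Fin n, ENNReal.ofReal (1 / n) := by
    calc ∑ i, expectedPayoff η s i ≤ ∫⁻ F, ∑ i, ENNReal.ofReal ((η F).selectProb F i)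
          ∂Measure.pi fun j => (s j : Measure (PureStrategy μ)) := sum_lintegral_le _ _ _
      _ ≤ ∫⁻ _, 1 ∂Measure.pi fun j => (s j : Measure (PureStrategy μ)) := by
          refine lintegral_mono fun F => ?_
          rw [← ENNReal.ofReal_sum_of_nonneg fun i _ => (η F).selectProb_nonneg F i,
            ENNReal.ofReal_le_one]
          exact (η F).sum_selectProb_le_one F
      _ = 1 := by simp
      _ = ∑ _i : Fin n, ENNReal.ofReal (1 / n) := by
          rw [← ENNReal.ofReal_sum_of_nonneg fun i _ => by positivity]
          have : (n : ℝ) ≠ 0 := by exact_mod_cast hn.ne'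
          simp [this]
  by_contra! hlt
  exact this.not_gt (ENNReal.sum_lt_sum_of_nonempty ⟨⟨0, hn⟩, Finset.mem_univ _⟩ fun i _ => hlt i)

/-! ### Full revelation is an equilibrium -/

section

variable (h0 : 0 < μ) (h1 : μ ≤ 1)

local notation "G₀" => PureStrategy.fullyRevealing μ h0.le h1

theorem Policy.IsOptimal.inv_le_selectProb {π : Policy n} {F : Fin n → PureStrategy μ}
    (hπ : π.IsOptimal c β F) (hfair : π.IsFair c β F) (H : Frictions μ c β) (hF : ∀ j, F j = G₀)
    (i : Fin n) : 1 / (n : ℝ) ≤ π.selectProb F i := by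
  have := hπ.share_le_selectProb (h0 := h0) (h1 := h1) hfair H (S := Finset.univ)
    (by simp [hF]) (Finset.mem_univ i) (Or.inr ⟨rfl, rfl⟩)
  have hn : (n : ℝ) ≠ 0 := by exact_mod_cast i.pos.ne'
  rw [Finset.card_univ, Fintype.card_fin, mul_one_div_cancel hn] at this
  simpa using this

theorem Policy.IsOptimal.selectProb_le_inv {π : Policy n} {F : Fin n → PureStrategy μ}
    (hπ : π.IsOptimal c β F) (hfair : π.IsFair c β F) (H : Frictions μ c β)
    (hq : (1 - μ) ^ (n - 1) ≤ 1 / n) {i : Fin n} (hF : ∀ j, j ≠ i → F j = G₀) :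
    π.selectProb F i ≤ 1 / n := by
  by_cases hi : F i = G₀
  · have hall : ∀ j, F j = G₀ := fun j => by
      rcases eq_or_ne j i with rfl | hj
      · exact hi
      · exact hF j hj
    have hn : (n : ℝ) ≠ 0 := by exact_mod_cast i.pos.ne'
    have hsum := π.sum_selectProb_le_one F
    have hge : ∑ _j ∈ Finset.univ.erase i, 1 / (n : ℝ) ≤
        ∑ j ∈ Finset.univ.erase i, π.selectProb F j :=
      Finset.sum_le_sum fun j _ => hπ.inv_le_selectProb h0 h1 hfair H hall j
    rw [← Finset.add_sum_erase _ _ (Finset.mem_univ i)] at hsum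
    have hone : 1 / (n : ℝ) + ∑ _j ∈ Finset.univ.erase i, 1 / (n : ℝ) = 1 := by
      rw [Finset.add_sum_erase _ (fun _ => 1 / (n : ℝ)) (Finset.mem_univ i)]
      simp [hn]
    linarith
  · exact (hπ.selectProb_le h0 h1 H hi hF).trans hq

theorem isSymmetricEquilibrium_fullyRevealing (H : Frictions μ c β) (hn : 0 < n)
    (hq : (1 - μ) ^ (n - 1) ≤ 1 / n) : IsSymmetricEquilibrium n c β (G₀).toMixed := by
  set η : (Fin n → PureStrategy μ) → Policy n := fun F => indexPolicy fun i => resPrice c β (F i)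
  have hopt : ∀ F, (η F).IsOptimal c β F := fun F =>
    Policy.isOptimal_of_tight H F (indexPolicy_tight H hn F)
  have hfair : ∀ F, (η F).IsFair c β F := fun F => indexPolicy_isFair H F
  refine ⟨η, hopt, hfair, fun i s' => ?_⟩
  refine (expectedPayoff_le (a := 1 / n) ?_).trans (le_expectedPayoff (a := 1 / n) ?_)
  · have : ∀ᵐ F ∂Measure.pi fun j => ((Function.update (fun _ => (G₀).toMixed) i s' j :
        MixedStrategy μ) : Measure (PureStrategy μ)), ∀ j, j ≠ i → F j = G₀ := by
      refine Filter.eventually_all.2 fun j => ?_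
      by_cases hj : j = i
      · exact Filter.Eventually.of_forall fun F h => absurd hj h
      · filter_upwards [ae_eq_of_toMixed (j := j) (G := G₀)
          (Function.update_of_ne hj s' fun _ => (G₀).toMixed)] with F hF _
        exact hF
    filter_upwards [this] with F hF
    exact (hopt F).selectProb_le_inv h0 h1 (hfair F) H hq hF
  · have : ∀ᵐ F ∂Measure.pi fun _ : Fin n => ((G₀).toMixed : Measure (PureStrategy μ)),
        ∀ j, F j = G₀ := Filter.eventually_all.2 fun j => ae_eq_of_toMixed rfl
    filter_upwards [this] with F hF
    exact (hopt F).inv_le_selectProb h0 h1 (hfair F) H hF i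

/-! ### No other equilibrium -/

/-- A box that reveals fully gets at least its fair share, whatever the other boxes do. -/
theorem Policy.IsOptimal.inv_le_selectProb_of_eq {π : Policy n} {F : Fin n → PureStrategy μ}
    (hπ : π.IsOptimal c β F) (hfair : π.IsFair c β F) (H : Frictions μ c β)
    (hq : (1 - μ) ^ (n - 1) ≤ 1 / n) {i : Fin n} (hi : F i = G₀) :
    1 / (n : ℝ) ≤ π.selectProb F i := by
  classical
  set S := Finset.univ.filter fun j => F j = G₀ with hS
  have hS' : ∀ j, j ∈ S ↔ F j = G₀ := by simp [hS]
  by_cases hall : S = Finset.univ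
  · exact hπ.inv_le_selectProb h0 h1 hfair H (fun j => (hS' j).1 (hall ▸ Finset.mem_univ j)) i
  · have hlt : S.card < n := by
      simpa using Finset.card_lt_univ_of_notMem
        (Classical.not_forall.1 fun h => hall (Finset.eq_univ_iff_forall.2 h)).choose_spec
    have h := hπ.share_le_selectProb (h0 := h0) (h1 := h1) hfair H hS' ((hS' i).2 hi)
      (Or.inl rfl)
    refine (inv_le_one_sub_pow_div (sub_nonneg.2 h1) (by linarith) hq
      (Finset.card_pos.2 ⟨i, (hS' i).2 hi⟩) hlt).trans (le_of_eq_of_le ?_ h)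
    ring

theorem Policy.IsOptimal.mean_le_selectProb {π : Policy n} {F : Fin n → PureStrategy μ}
    (hπ : π.IsOptimal c β F) (hfair : π.IsFair c β F) (H : Frictions μ c β) {i : Fin n}
    (hi : F i = G₀) (hF : ∀ j, j ≠ i → F j ≠ G₀) : μ ≤ π.selectProb F i := by
  have h := hπ.share_le_selectProb (h0 := h0) (h1 := h1) hfair H (S := {i}) (i := i)
    (fun j => ?_) (by simp) (Or.inl rfl)
  · simpa using h
  · rw [Finset.mem_singleton]
    refine ⟨fun e => e ▸ hi, fun e => ?_⟩
    by_contra hne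
    exact hF j hne e

theorem eq_fullyRevealing_of_isSymmetricEquilibrium (H : Frictions μ c β) (hn : 0 < n)
    (hq : (1 - μ) ^ (n - 1) ≤ 1 / n) (hμ : 1 / (n : ℝ) < μ) {s : MixedStrategy μ}
    (hs : IsSymmetricEquilibrium n c β s) : s = (G₀).toMixed := by
  obtain ⟨η, hη⟩ := hs
  by_contra hne
  obtain ⟨i, hi⟩ := exists_expectedPayoff_le hn η fun _ => s
  have hdev := (hη.best_response i (G₀).toMixed).trans hi
  set s' : Fin n → MixedStrategy μ := Function.update (fun _ => s) i (G₀).toMixed with hs'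
  set A : Set (Fin n → PureStrategy μ) := Set.univ.pi fun j => if j = i then Set.univ else {G₀}ᶜ
    with hA
  have hAm : MeasurableSet A := MeasurableSet.univ_pi fun j => by
    split_ifs
    · exact MeasurableSet.univ
    · exact (measurableSet_singleton _).compl
  have hApos : (Measure.pi fun j => (s' j : Measure (PureStrategy μ))) A ≠ 0 := by
    rw [hA, Measure.pi_pi]
    refine Finset.prod_ne_zero_iff.2 fun j _ => ?_
    by_cases hj : j = i
    · simp [hj]
    · rw [if_neg hj, hs', Function.update_of_ne hj]
      intro h
      exact hne (eq_toMixed_of_measure_singleton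
        ((prob_compl_eq_zero_iff (measurableSet_singleton _)).1 h))
  have hlow : ∫⁻ F, (ENNReal.ofReal (1 / n) + A.indicator (fun _ => ENNReal.ofReal (μ - 1 / n)) F)
      ∂(Measure.pi fun j => (s' j : Measure (PureStrategy μ))) ≤ expectedPayoff η s' i := by
    refine lintegral_mono_ae ?_
    filter_upwards [ae_eq_of_toMixed (s := s') (j := i) (G := G₀) (by rw [hs']; simp)] with F hF
    by_cases hFA : F ∈ A
    · rw [Set.indicator_of_mem hFA, ← ENNReal.ofReal_add (by positivity) (by linarith),
        add_sub_cancel]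
      refine ENNReal.ofReal_le_ofReal ?_
      refine (hη.optimal F).mean_le_selectProb h0 h1 (hη.fair F) H hF fun j hj => ?_
      have := hFA j (Set.mem_univ j)
      simp only [if_neg hj] at this
      exact this
    · rw [Set.indicator_of_notMem hFA, add_zero]
      exact ENNReal.ofReal_le_ofReal
        ((hη.optimal F).inv_le_selectProb_of_eq h0 h1 (hη.fair F) H hq hF)
  rw [lintegral_add_left measurable_const, lintegral_indicator hAm, setLIntegral_const,
    lintegral_const, measure_univ, mul_one] at hlow
  have hpos : ENNReal.ofReal (μ - 1 / n) *
      (Measure.pi fun j => (s' j : Measure (PureStrategy μ))) A ≠ 0 :=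
    mul_ne_zero (by simpa using hμ) hApos
  exact absurd (hlow.trans hdev) (not_le.2 (ENNReal.lt_add_right ENNReal.ofReal_ne_top hpos))

/-- Moving the good news of a fully revealing signal slightly below `1` makes it more likely and
keeps the reservation price above any `z` that full revelation beats. -/
theorem Frictions.exists_likelier_news (H : Frictions μ c β) (hμ1 : μ < 1) {z : ℝ} (hz0 : 0 ≤ z)
    (hz : z < resPrice c β G₀) : ∃ F : PureStrategy μ, z < resPrice c β F ∧
      μ < F.law.real {t : I | z < t} := by
  have hpos := H.surplus_pos_of_lt _ hz (H.surplus_resPrice G₀).ge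
  have hz1 : z < 1 := hz.trans (H.resPrice_lt_one _)
  have hG : surplus c β G₀ z = -c + β * (μ + (1 - μ / 1) * z) - z := by
    unfold surplus
    rw [integral_fullyRevealing]
    have e0 : max ((0 : I) : ℝ) z = z := max_eq_right (by simpa using hz0)
    have e1 : max ((1 : I) : ℝ) z = 1 := max_eq_left (by simpa using hz1.le)
    rw [e0, e1]; ring
  rw [hG] at hpos
  have hcont : ContinuousAt (fun a : ℝ => -c + β * (μ + (1 - μ / a) * z) - z) 1 := by
    have : ContinuousAt (fun a : ℝ => μ / a) 1 := continuousAt_const.div continuousAt_id one_ne_zero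
    fun_prop
  have hev : ∀ᶠ a : ℝ in nhdsWithin 1 (Set.Iio 1),
      (0 < -c + β * (μ + (1 - μ / a) * z) - z ∧ max μ z < a) ∧ a < 1 :=
    (((hcont.eventually (lt_mem_nhds hpos)).and (lt_mem_nhds (max_lt hμ1 hz1))).filter_mono
      nhdsWithin_le_nhds).and self_mem_nhdsWithin
  obtain ⟨a, ⟨ha, hmax⟩, ha1⟩ := hev.exists
  have hμa : μ < a := (le_max_left _ _).trans_lt hmax
  have hza : z < a := (le_max_right _ _).trans_lt hmax
  have ha0 : 0 < a := h0.trans hμa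
  set p := μ / a with hp
  have hp0 : 0 ≤ p := (div_pos h0 ha0).le
  have hp1 : p ≤ 1 := (div_le_one ha0).2 hμa.le
  have hpa : p * a = μ := div_mul_cancel₀ _ ha0.ne'
  set b : I := ⟨a, ha0.le, ha1.le⟩ with hb
  set m : Measure I := ENNReal.ofReal (1 - p) • Measure.dirac (0 : I) +
    ENNReal.ofReal p • Measure.dirac b with hm
  have hmp : IsProbabilityMeasure m := ⟨by
    have h : (0 : ℝ) ≤ 1 - p := by linarith
    simp [hm, ← ENNReal.ofReal_add h hp0]⟩
  have hint : ∀ f : I → ℝ, ∫ x, f x ∂m = (1 - p) * f 0 + p * f b := fun f => by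
    have hi : ∀ a : I, Integrable f (Measure.dirac a) := fun a => integrable_dirac (by simp)
    rw [hm, integral_add_measure ((hi 0).smul_measure ENNReal.ofReal_ne_top)
      ((hi b).smul_measure ENNReal.ofReal_ne_top)]
    simp [hp0, hp1]
  set F : PureStrategy μ := ⟨⟨m, hmp⟩, by
    rw [ProbabilityMeasure.coe_mk, hint]; simp [hb, hpa]⟩ with hF
  have hlaw : F.law = m := rfl
  refine ⟨F, H.lt_resPrice ?_, ?_⟩
  · unfold surplus
    rw [hlaw, hint]
    have e0 : max ((0 : I) : ℝ) z = z := max_eq_right (by simpa using hz0)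
    have e1 : max (b : ℝ) z = a := max_eq_left hza.le
    rw [e0, e1, hpa]
    linarith
  · rw [hlaw]
    calc μ < p := by rw [hp, lt_div_iff₀ ha0]; nlinarith
      _ = (ENNReal.ofReal p).toReal := (ENNReal.toReal_ofReal hp0).symm
      _ ≤ m.real {t : I | z < t} := by
        refine ENNReal.toReal_mono (measure_ne_top _ _) ?_
        rw [hm, Measure.add_apply, Measure.smul_apply, Measure.smul_apply,
          Measure.dirac_apply_of_mem (a := b) (by exact hza)]
        simp

theorem eq_fullyRevealing_of_isSymmetricEquilibrium_pure (H : Frictions μ c β) (hn : 0 < n)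
    (hμ1 : μ < 1) (hμ : 1 / (n : ℝ) ≤ μ) {F : PureStrategy μ}
    (hF : IsSymmetricEquilibrium n c β F.toMixed) : F = G₀ := by
  obtain ⟨η, hη⟩ := hF
  by_contra hne
  obtain ⟨K, hK, hKμ⟩ := H.exists_likelier_news h0 h1 hμ1 (H.resPrice_pos F).le
    (H.resPrice_lt h0 h1 hne)
  obtain ⟨i, hi⟩ := exists_expectedPayoff_le hn η fun _ => F.toMixed
  have hdev := (hη.best_response i K.toMixed).trans hi
  set s' : Fin n → MixedStrategy μ := Function.update (fun _ => F.toMixed) i K.toMixed with hs'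
  have hae : ∀ᵐ P ∂Measure.pi fun j => (s' j : Measure (PureStrategy μ)),
      ∀ j, P j = if j = i then K else F := by
    refine Filter.eventually_all.2 fun j => ae_eq_of_toMixed ?_
    rcases eq_or_ne j i with rfl | hj
    · simp [hs']
    · rw [hs', Function.update_of_ne hj, if_neg hj]
  have hlow := le_expectedPayoff (η := η) (s := s') (i := i)
    (a := K.law.real {t : I | resPrice c β F < t}) (by
      filter_upwards [hae] with P hP
      have hPi : P i = K := by rw [hP i, if_pos rfl]
      have hPj : ∀ j, j ≠ i → P j = F := fun j hj => by rw [hP j, if_neg hj]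
      refine le_trans ?_ ((hη.optimal P).le_selectProb H hn (i := i) fun j hj => by
        rw [hPi, hPj j hj]; exact hK)
      rw [hPi]
      refine measureReal_mono fun t ht j hj => ?_
      rw [hPj j hj]
      exact ht)
  have := (ENNReal.ofReal_le_ofReal_iff (by positivity)).1 (hlow.trans hdev)
  linarith

theorem isSymmetricEquilibrium_toMixed_iff (H : Frictions μ c β) (hn : 2 ≤ n)
    (hq : (1 - μ) ^ (n - 1) ≤ 1 / n) (F : PureStrategy μ) :
    IsSymmetricEquilibrium n c β F.toMixed ↔ F = G₀ := by
  constructor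
  · intro hF
    by_cases hex : n = 2 ∧ μ = 1 / 2
    · obtain ⟨rfl, hμ⟩ := hex
      refine eq_fullyRevealing_of_isSymmetricEquilibrium_pure h0 h1 H two_pos ?_ ?_ hF
      · rw [hμ]; norm_num
      · rw [hμ]; norm_num
    · exact toMixed_injective (eq_fullyRevealing_of_isSymmetricEquilibrium h0 h1 H (by omega) hq
        (inv_lt_mean hn h0 h1 hq hex) hF)
  · rintro rfl
    exact isSymmetricEquilibrium_fullyRevealing h0 h1 H (by omega) hq

end

end PandoraGame

theorem theorem6 :
    -- a sufficiently high mean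
    (∀ (n : ℕ) (μ c β : ℝ) (h0 : 0 < μ) (h1 : μ ≤ 1),
      2 ≤ n → PandoraGame.Frictions μ c β →
      1 - (1 / (n : ℝ)) ^ (1 / ((n : ℝ) - 1)) ≤ μ →
      -- in pure strategies, full information is the unique symmetric equilibrium
      (∀ F : PandoraGame.PureStrategy μ,
        PandoraGame.IsSymmetricEquilibrium n c β F.toMixed ↔
          F = PandoraGame.PureStrategy.fullyRevealing μ h0.le h1) ∧
      -- and, apart from one boundary case, also in mixed strategies
      (¬ (n = 2 ∧ μ = 1 / 2) → ∀ s : PandoraGame.MixedStrategy μ,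
        PandoraGame.IsSymmetricEquilibrium n c β s ↔
          s = (PandoraGame.PureStrategy.fullyRevealing μ h0.le h1).toMixed)) ∧
    -- a fixed mean and sufficiently many boxes
    (∀ (μ : ℝ) (h0 : 0 < μ) (h1 : μ < 1), ∃ N : ℕ, ∀ n : ℕ, N ≤ n →
      ∀ c β : ℝ, PandoraGame.Frictions μ c β →
      ∀ F : PandoraGame.PureStrategy μ,
        PandoraGame.IsSymmetricEquilibrium n c β F.toMixed ↔
          F = PandoraGame.PureStrategy.fullyRevealing μ h0.le h1.le) ∧
    -- every reservation price is well defined, and the prior uniquely maximizes it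
    (∀ (μ c β : ℝ) (h0 : 0 < μ) (h1 : μ ≤ 1), PandoraGame.Frictions μ c β →
      (∀ F : PandoraGame.PureStrategy μ, ∃! z : ℝ, PandoraGame.IsReservationPrice c β F z) ∧
      (∀ (F : PandoraGame.PureStrategy μ) (z z₀ : ℝ),
        F ≠ PandoraGame.PureStrategy.fullyRevealing μ h0.le h1 →
        PandoraGame.IsReservationPrice c β F z →
        PandoraGame.IsReservationPrice c β
          (PandoraGame.PureStrategy.fullyRevealing μ h0.le h1) z₀ →
        z < z₀)) := by
  refine ⟨fun n μ c β h0 h1 hn H hμ => ?_, fun μ h0 h1 => ?_, fun μ c β h0 h1 H => ?_⟩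
  · have hq := PandoraGame.pow_le_inv_of_rpow_le hn h1 hμ
    refine ⟨PandoraGame.isSymmetricEquilibrium_toMixed_iff h0 h1 H hn hq, fun hex s => ⟨?_, ?_⟩⟩
    · exact PandoraGame.eq_fullyRevealing_of_isSymmetricEquilibrium h0 h1 H (by omega) hq
        (PandoraGame.inv_lt_mean hn h0 h1 hq hex)
    · rintro rfl
      exact PandoraGame.isSymmetricEquilibrium_fullyRevealing h0 h1 H (by omega) hq
  · obtain ⟨N, hN⟩ := PandoraGame.exists_pow_le_inv h0 h1
    exact ⟨max N 2, fun n hn c β H => PandoraGame.isSymmetricEquilibrium_toMixed_iff h0 h1.le H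
      ((le_max_right _ _).trans hn) (hN n ((le_max_left _ _).trans hn))⟩
  · refine ⟨H.existsUnique, fun F z z₀ hF hz hz₀ => ?_⟩
    rw [H.eq_resPrice hz, H.eq_resPrice hz₀]
    exact H.resPrice_lt h0 h1 hF
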